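/- Let $\mathbb{F}$ be a field of characteristic not two and let $\mathcal{C}$ be a Cayley algebra over $\mathbb{F}$, that is, an eight-dimensional unital (nonassociative) algebra with unity $e_0$, endowed with a nondegenerate quadratic form $\mathrm{n}$ such that $\mathrm{n}(xy)=\mathrm{n}(x)\mathrm{n}(y)$ for all $x,y$. Write $\mathrm{n}(x,y)=\mathrm{n}(x+y)-\mathrm{n}(x)-\mathrm{n}(y)$, $\bar x=\mathrm{n}(x,e_0)e_0-x$, $\mathcal{C}_0=\{x\in\mathcal{C}\mid \mathrm{n}(x,e_0)=0\}$, and let $x\bullet y=\bar x\bar y$ be the para-Cayley product, with $l_x(y)=x\bullet y$ and $r_x(y)=y\bullet x$. Affine group schemes are viewed as functors from commutative $\mathbb{F}$-algebras $R$ to groups, and a subscript $R$ denotes extension of scalars to $R$. For a quadratic space $(V,q)$, let $\mathrm{Cl}(V,q)$ be its Clifford algebra (with $x\cdot x=q(x)1$ for $x\in V$), $\tau$ its canonical involution (the identity on $V$), and let $\mathbf{Spin}(V,q)(R)$ be the group of the invertible even elements $u$ of $\mathrm{Cl}(V,q)_R$ with $u\cdot\tau(u)=1$ and $u\cdot V_R\cdot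 u^{-1}=V_R$. For $u\in\mathbf{Spin}(V,q)(R)$ and $x\in V_R$ put $\chi_u(x)=u\cdot x\cdot u^{-1}$. Let $\mathbf{O}^+(\mathcal{C},\mathrm{n})(R)$ be the group of $R$-linear automorphisms of $\mathcal{C}_R$ of determinant one that preserve $\mathrm{n}_R$. Let $\Phi:\mathrm{Cl}(\mathcal{C},\mathrm{n})\to\mathrm{End}_{\mathbb{F}}(\mathcal{C}\oplus\mathcal{C})$ be the algebra homomorphism with $\Phi(x)=\begin{pmatrix}0&l_x\\ r_x&0\end{pmatrix}$ for $x\in\mathcal{C}$; for $u\in\mathbf{Spin}(\mathcal{C},\mathrm{n})(R)$ write $\Phi_R(u)=\begin{pmatrix}\rho_u^-&0\\0&\rho_u^+\end{pmatrix}$. Let $\Psi:\mathrm{Cl}(\mathcal{C}_0,-\mathrm{n})\to\mathrm{Cl}(\mathcal{C},\mathrm{n})$ be the algebra homomorphism with $\Psi(x)=e_0\cdot x$ for $x\in\mathcal{C}_0$. Then the assignment $u\mapsto(\chi_u,\rho_u^+,\rho_u^-)$ is an isomorphism of affine group schemes $$\mathbf{Spin}(\mathcal{C},\mathrm{n})\cong\{(f_0,f_1,f_2)\in\mathbf{O}^+(\mathcal{C},\mathrm{n})^3\mid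 f_0(x\bullet y)=f_1(x)\bullet f_2(y)\ \forall x,y\},$$ $\Psi$ restricts to a homomorphism of affine group schemes $\mathbf{Spin}(\mathcal{C}_0,-\mathrm{n})\to\mathbf{Spin}(\mathcal{C},\mathrm{n})$, and the composition $u\mapsto\bigl(\chi_{\Psi(u)},\rho^+_{\Psi(u)},\rho^-_{\Psi(u)}\bigr)$ of both is an isomorphism of affine group schemes $$\mathbf{Spin}(\mathcal{C}_0,-\mathrm{n})\cong\{(f_0,f_1,f_2)\in\mathbf{O}^+(\mathcal{C},\mathrm{n})^3\mid f_0(x\bullet y)=f_1(x)\bullet f_2(y)\ \forall x,y,\ \text{and } f_0(e_0)=e_0\}.$$ Here, on $R$-points, $x$ and $y$ range over $\mathcal{C}_R$. -/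

import Mathlib

universe u v w w'

open TensorProduct CategoryTheory

noncomputable section

namespace SpinTriality

section ScalarExtension

variable {F : Type u} [Field F]
variable {R : Type w} [CommRing R] [Algebra F R] {S : Type w'} [CommRing S] [Algebra F S]

/-- The map `V_R → V_S` induced by a homomorphism `φ : R → S` of commutative `F`-algebras, where
`V_R = R ⊗ V`. -/
def scalarMap (φ : R →ₐ[F] S) (V : Type v) [AddCommGroup V] [Module F V] :
    R ⊗[F] V →ₗ[F] S ⊗[F] V :=
  LinearMap.rTensor V φ.toLinearMap

variable {V : Type v} [AddCommGroup V] [Module F V]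

@[simp] theorem scalarMap_tmul (φ : R →ₐ[F] S) (r : R) (v : V) :
    scalarMap φ V (r ⊗ₜ[F] v) = φ r ⊗ₜ[F] v := by
  simp [scalarMap]

theorem scalarMap_smul (φ : R →ₐ[F] S) (r : R) (x : R ⊗[F] V) :
    scalarMap φ V (r • x) = φ r • scalarMap φ V x := by
  induction x using TensorProduct.induction_on with
  | zero => simp
  | tmul s v => simp [TensorProduct.smul_tmul']
  | add x y hx hy => simp [hx, hy]

/-- `S`-linear maps out of `V_S` are determined by their values on the image of `V_R`. -/
theorem linearMap_ext_scalarMap {M : Type*} [AddCommGroup M] [Module S M] (φ : R →ₐ[F] S)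
    {f g : S ⊗[F] V →ₗ[S] M} (h : ∀ x : R ⊗[F] V, f (scalarMap φ V x) = g (scalarMap φ V x)) :
    f = g := by
  refine LinearMap.ext fun y => ?_
  induction y using TensorProduct.induction_on with
  | zero => simp
  | tmul s v =>
    have h' : (s ⊗ₜ[F] v : S ⊗[F] V) = s • scalarMap φ V (1 ⊗ₜ[F] v) := by
      simp [TensorProduct.smul_tmul']
    rw [h', map_smul, map_smul, h]
  | add x y hx hy => rw [map_add, map_add, hx, hy]

/-- The extension to `V_S` of an `R`-linear endomorphism of `V_R`, along `φ : R → S`. -/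
def endExt (φ : R →ₐ[F] S) (f : Module.End R (R ⊗[F] V)) : Module.End S (S ⊗[F] V) :=
  LinearMap.liftBaseChange S
    (scalarMap φ V ∘ₗ f.restrictScalars F ∘ₗ TensorProduct.mk F R V 1)

theorem endExt_scalarMap (φ : R →ₐ[F] S) (f : Module.End R (R ⊗[F] V)) (x : R ⊗[F] V) :
    endExt φ f (scalarMap φ V x) = scalarMap φ V (f x) := by
  induction x using TensorProduct.induction_on with
  | zero => simp
  | tmul r v =>
    have h : f (r ⊗ₜ[F] v) = r • f (1 ⊗ₜ[F] v) := by
      rw [← map_smul, TensorProduct.smul_tmul', smul_eq_mul, mul_one]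
    rw [h, scalarMap_smul]
    simp [endExt]
  | add x y hx hy => simp [hx, hy]

/-- Scalar extension along `φ : R → S` is multiplicative on endomorphisms. -/
def endMap (φ : R →ₐ[F] S) (V : Type v) [AddCommGroup V] [Module F V] :
    Module.End R (R ⊗[F] V) →* Module.End S (S ⊗[F] V) where
  toFun := endExt φ
  map_one' := linearMap_ext_scalarMap φ fun x => by rw [endExt_scalarMap]; rfl
  map_mul' f g := linearMap_ext_scalarMap φ fun x => by
    rw [endExt_scalarMap, Module.End.mul_apply, Module.End.mul_apply, endExt_scalarMap,
      endExt_scalarMap]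

theorem endMap_scalarMap (φ : R →ₐ[F] S) (f : Module.End R (R ⊗[F] V)) (x : R ⊗[F] V) :
    endMap φ V f (scalarMap φ V x) = scalarMap φ V (f x) :=
  endExt_scalarMap φ f x

theorem det_endMap [Module.Finite F V] (φ : R →ₐ[F] S) (f : Module.End R (R ⊗[F] V)) :
    LinearMap.det (endMap φ V f) = φ (LinearMap.det f) := by
  classical
  let b := Module.finBasis F V
  rw [← LinearMap.det_toMatrix (Algebra.TensorProduct.basis S b),
    ← LinearMap.det_toMatrix (Algebra.TensorProduct.basis R b), AlgHom.map_det]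
  congr 1
  ext i j
  have key : ∀ (x : R ⊗[F] V), (Algebra.TensorProduct.basis S b).repr (scalarMap φ V x) i =
      φ ((Algebra.TensorProduct.basis R b).repr x i) := by
    intro x
    induction x using TensorProduct.induction_on with
    | zero => simp
    | tmul r v => simp [Algebra.TensorProduct.basis_repr_tmul]
    | add x y hx hy => simp [hx, hy]
  have hb : (Algebra.TensorProduct.basis S b) j =
      scalarMap φ V ((Algebra.TensorProduct.basis R b) j) := by simp
  simp only [LinearMap.toMatrix_apply, AlgHom.mapMatrix_apply, Matrix.map_apply]
  rw [hb, endMap_scalarMap, key]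

end ScalarExtension

section SpecialOrthogonal

variable {F : Type u} [Field F] [Invertible (2 : F)]
variable {V : Type v} [AddCommGroup V] [Module F V]

/-- The group of `R`-points of the special orthogonal group scheme `O⁺(V, q)`: the `R`-linear
automorphisms of `V_R` of determinant one that preserve the extended quadratic form. -/
def specialOrthogonal (q : QuadraticForm F V) (R : Type w) [CommRing R] [Algebra F R] :
    Subgroup (LinearMap.GeneralLinearGroup R (R ⊗[F] V)) where
  carrier := {f | (∀ x, q.baseChange R ((f : Module.End R (R ⊗[F] V)) x) = q.baseChange R x) ∧
    LinearMap.det (f : Module.End R (R ⊗[F] V)) = 1}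
  one_mem' := by simp
  mul_mem' := by
    rintro f g ⟨hf, hf'⟩ ⟨hg, hg'⟩
    exact ⟨fun x => by simp [hf, hg], by simp [hf', hg']⟩
  inv_mem' := by
    rintro f ⟨hf, hf'⟩
    refine ⟨fun x => ?_, ?_⟩
    · rw [← hf, ← Module.End.mul_apply, ← Units.val_mul, mul_inv_cancel]
      rfl
    · have h : LinearMap.det ((f : Module.End R (R ⊗[F] V)) * ((f⁻¹ : LinearMap.GeneralLinearGroup
          R (R ⊗[F] V)) : Module.End R (R ⊗[F] V))) = 1 := by
        rw [← Units.val_mul, mul_inv_cancel]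
        simp
      rwa [map_mul, hf', one_mul] at h

variable {R : Type w} [CommRing R] [Algebra F R] {S : Type w'} [CommRing S] [Algebra F S]

theorem polar_scalarMap (q : QuadraticForm F V) (φ : R →ₐ[F] S) (x y : R ⊗[F] V) :
    QuadraticMap.polarBilin (q.baseChange S) (scalarMap φ V x) (scalarMap φ V y) =
      φ (QuadraticMap.polarBilin (q.baseChange R) x y) := by
  let _ : Invertible (2 : R) :=
    (Invertible.map (algebraMap F R) (2 : F)).copy 2 (map_ofNat _ 2).symm
  let _ : Invertible (2 : S) :=
    (Invertible.map (algebraMap F S) (2 : F)).copy 2 (map_ofNat _ 2).symm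
  rw [QuadraticForm.polarBilin_baseChange, QuadraticForm.polarBilin_baseChange]
  induction x using TensorProduct.induction_on with
  | zero => simp
  | add x x' hx hx' => simp only [map_add, LinearMap.add_apply, hx, hx']
  | tmul r v =>
    induction y using TensorProduct.induction_on with
    | zero => simp
    | add x x' hx hx' => simp only [map_add, hx, hx']
    | tmul s w => simp [LinearMap.BilinForm.baseChange_tmul]

theorem specialOrthogonal_map [Module.Finite F V] (q : QuadraticForm F V) (φ : R →ₐ[F] S)
    {f : LinearMap.GeneralLinearGroup R (R ⊗[F] V)} (hf : f ∈ specialOrthogonal q R) :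
    Units.map (endMap φ V) f ∈ specialOrthogonal q S := by
  let _ : Invertible (2 : S) :=
    (Invertible.map (algebraMap F S) (2 : F)).copy 2 (map_ofNat _ 2).symm
  obtain ⟨hf, hf'⟩ := hf
  refine ⟨?_, by rw [Units.coe_map, det_endMap, hf', map_one]⟩
  have h1 : ∀ x y, QuadraticMap.polarBilin (q.baseChange R)
      ((f : Module.End R (R ⊗[F] V)) x) ((f : Module.End R (R ⊗[F] V)) y) =
      QuadraticMap.polarBilin (q.baseChange R) x y := by
    intro x y
    simp only [QuadraticMap.polarBilin_apply_apply, QuadraticMap.polar, ← map_add, hf]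
  have h2 : (QuadraticMap.polarBilin (q.baseChange S)).compl₁₂ (endMap φ V f) (endMap φ V f) =
      QuadraticMap.polarBilin (q.baseChange S) := by
    refine linearMap_ext_scalarMap φ fun x => linearMap_ext_scalarMap φ fun y => ?_
    rw [LinearMap.compl₁₂_apply, endMap_scalarMap, endMap_scalarMap, polar_scalarMap,
      polar_scalarMap, h1]
  intro x
  have h3 := LinearMap.congr_fun₂ h2 x x
  rw [LinearMap.compl₁₂_apply, QuadraticMap.polarBilin_apply_apply,
    QuadraticMap.polarBilin_apply_apply, QuadraticMap.polar_self, QuadraticMap.polar_self] at h3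
  have h4 : (2 : S) * q.baseChange S (endMap φ V f x) = 2 * q.baseChange S x := by
    simpa [two_smul, two_mul] using h3
  exact (isUnit_of_invertible (2 : S)).mul_left_cancel h4

end SpecialOrthogonal

section Spin

variable {F : Type u} [Field F] {V : Type v} [AddCommGroup V] [Module F V]

/-- The inclusion of `V_R` in the Clifford algebra `Cl(V, q)_R`. -/
def iotaExt (q : QuadraticForm F V) (R : Type w) [CommRing R] [Algebra F R] :
    R ⊗[F] V →ₗ[R] R ⊗[F] CliffordAlgebra q :=
  (CliffordAlgebra.ι q).baseChange R

/-- The canonical involution `τ` of `Cl(V, q)_R`, which is the identity on vectors. -/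
def tauExt (q : QuadraticForm F V) (R : Type w) [CommRing R] [Algebra F R] :
    R ⊗[F] CliffordAlgebra q →ₗ[R] R ⊗[F] CliffordAlgebra q :=
  (CliffordAlgebra.reverse (Q := q)).baseChange R

/-- The even part of `Cl(V, q)_R`. -/
def evenExt (q : QuadraticForm F V) (R : Type w) [CommRing R] [Algebra F R] :
    Subalgebra R (R ⊗[F] CliffordAlgebra q) :=
  (CliffordAlgebra.even q).baseChange R

section
variable (q : QuadraticForm F V) {R : Type w} [CommRing R] [Algebra F R]

theorem tauExt_mul (x y : R ⊗[F] CliffordAlgebra q) :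
    tauExt q R (x * y) = tauExt q R y * tauExt q R x := by
  induction x using TensorProduct.induction_on with
  | zero => simp
  | add x x' hx hx' => simp only [add_mul, mul_add, map_add, hx, hx']
  | tmul r a =>
    induction y using TensorProduct.induction_on with
    | zero => simp
    | add x x' hx hx' => simp only [add_mul, mul_add, map_add, hx, hx']
    | tmul s b => simp [tauExt, mul_comm]

theorem tauExt_one : tauExt q R 1 = 1 := by
  simp [tauExt, Algebra.TensorProduct.one_def]

theorem tauExt_mem_evenExt {x : R ⊗[F] CliffordAlgebra q} (hx : x ∈ evenExt q R) :
    tauExt q R x ∈ evenExt q R := by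
  have hx' : x ∈ (CliffordAlgebra.even q).toSubmodule.baseChange R := hx
  change tauExt q R x ∈ (CliffordAlgebra.even q).toSubmodule.baseChange R
  rw [Submodule.baseChange_eq_span] at hx' ⊢
  clear hx
  induction hx' using Submodule.span_induction with
  | zero => simp
  | add x y _ _ h h' => rw [map_add]; exact add_mem h h'
  | smul r x _ h => rw [map_smul]; exact Submodule.smul_mem _ _ h
  | mem x h =>
    obtain ⟨a, ha, rfl⟩ := h
    refine Submodule.subset_span ⟨CliffordAlgebra.reverse a, ?_, by simp [tauExt]⟩
    exact CliffordAlgebra.reverse_mem_evenOdd_iff q |>.2 ha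

end

/-- The group of `R`-points of the spin group scheme: the even elements `u` of the Clifford
algebra with `u · τ(u) = 1` and `u · V_R · u⁻¹ = V_R`. -/
def spin (q : QuadraticForm F V) (R : Type w) [CommRing R] [Algebra F R] :
    Subgroup (R ⊗[F] CliffordAlgebra q)ˣ where
  carrier := {u | (u : R ⊗[F] CliffordAlgebra q) ∈ evenExt q R ∧
    (u : R ⊗[F] CliffordAlgebra q) * tauExt q R u = 1 ∧
    (fun y : R ⊗[F] CliffordAlgebra q => (u : R ⊗[F] CliffordAlgebra q) * y * ↑u⁻¹) ''
      Set.range (iotaExt q R) = Set.range (iotaExt q R)}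
  one_mem' := ⟨one_mem _, by simp [tauExt_one], by simp⟩
  mul_mem' := by
    rintro a b ⟨ha, ha', ha''⟩ ⟨hb, hb', hb''⟩
    refine ⟨by rw [Units.val_mul]; exact mul_mem ha hb, ?_, ?_⟩
    · rw [Units.val_mul, tauExt_mul, mul_assoc, ← mul_assoc (b : R ⊗[F] CliffordAlgebra q), hb',
        one_mul, ha']
    · conv_rhs => rw [← ha'', ← hb'', Set.image_image]
      simp [mul_assoc]
  inv_mem' := by
    rintro a ⟨ha, ha', ha''⟩
    have h : ((a⁻¹ : (R ⊗[F] CliffordAlgebra q)ˣ) : R ⊗[F] CliffordAlgebra q) = tauExt q R a :=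
      Units.inv_eq_of_mul_eq_one_right ha'
    refine ⟨by rw [h]; exact tauExt_mem_evenExt q ha, ?_, ?_⟩
    · have h2 : tauExt q R ((a : R ⊗[F] CliffordAlgebra q) *
          ((a⁻¹ : (R ⊗[F] CliffordAlgebra q)ˣ) : R ⊗[F] CliffordAlgebra q)) = 1 := by
        rw [Units.mul_inv, tauExt_one]
      rw [tauExt_mul] at h2
      rw [← h] at h2
      have h3 := congrArg (fun z => z * (a : R ⊗[F] CliffordAlgebra q)) h2
      have h4 : tauExt q R ((a⁻¹ : (R ⊗[F] CliffordAlgebra q)ˣ) : R ⊗[F] CliffordAlgebra q) =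
          a := by simpa using h3
      rw [h4, Units.inv_mul]
    · conv_lhs => rw [← ha'', Set.image_image]
      simp [mul_assoc]

variable {R : Type w} [CommRing R] [Algebra F R] {S : Type w'} [CommRing S] [Algebra F S]

/-- The ring homomorphism `Cl(V, q)_R → Cl(V, q)_S` induced by `φ : R → S`. -/
def cliffordMap (φ : R →ₐ[F] S) (q : QuadraticForm F V) :
    R ⊗[F] CliffordAlgebra q →ₐ[F] S ⊗[F] CliffordAlgebra q :=
  Algebra.TensorProduct.map φ (AlgHom.id F (CliffordAlgebra q))

theorem spin_map (φ : R →ₐ[F] S) (q : QuadraticForm F V) {a : (R ⊗[F] CliffordAlgebra q)ˣ}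
    (ha : a ∈ spin q R) :
    Units.map (cliffordMap φ q : R ⊗[F] CliffordAlgebra q →* S ⊗[F] CliffordAlgebra q) a ∈
      spin q S := by
  have htau : ∀ x, tauExt q S (cliffordMap φ q x) = cliffordMap φ q (tauExt q R x) := by
    intro x
    induction x using TensorProduct.induction_on with
    | zero => simp
    | add x x' hx hx' => simp only [map_add, hx, hx']
    | tmul r c => simp [tauExt, cliffordMap]
  have hiota : ∀ x, iotaExt q S (scalarMap φ V x) = cliffordMap φ q (iotaExt q R x) := by
    intro x
    induction x using TensorProduct.induction_on with
    | zero => simp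
    | add x x' hx hx' => simp only [map_add, hx, hx']
    | tmul r c => simp [iotaExt, cliffordMap]
  have hconj : ∀ b : (R ⊗[F] CliffordAlgebra q)ˣ, b ∈ spin q R → ∀ y : S ⊗[F] V,
      cliffordMap φ q b * iotaExt q S y *
        cliffordMap φ q ((b⁻¹ : (R ⊗[F] CliffordAlgebra q)ˣ) : R ⊗[F] CliffordAlgebra q) ∈
          Set.range (iotaExt q S) := by
    intro b hb y
    induction y using TensorProduct.induction_on with
    | zero => exact ⟨0, by simp⟩
    | add x x' hx hx' =>
      obtain ⟨z, hz⟩ := hx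
      obtain ⟨z', hz'⟩ := hx'
      exact ⟨z + z', by simp only [map_add, hz, hz', mul_add, add_mul]⟩
    | tmul s v =>
      have h1 : (b : R ⊗[F] CliffordAlgebra q) * iotaExt q R (1 ⊗ₜ v) *
          ((b⁻¹ : (R ⊗[F] CliffordAlgebra q)ˣ) : R ⊗[F] CliffordAlgebra q) ∈
            Set.range (iotaExt q R) := by
        rw [← hb.2.2]
        exact ⟨_, ⟨_, rfl⟩, rfl⟩
      obtain ⟨z, hz⟩ := h1
      refine ⟨s • scalarMap φ V z, ?_⟩
      have h2 : (s ⊗ₜ[F] v : S ⊗[F] V) = s • scalarMap φ V (1 ⊗ₜ[F] v) := by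
        simp [TensorProduct.smul_tmul']
      rw [h2, map_smul, map_smul, hiota, hiota, hz, map_mul, map_mul, mul_smul_comm,
        smul_mul_assoc]
  refine ⟨?_, ?_, ?_⟩
  · have hx' : (a : R ⊗[F] CliffordAlgebra q) ∈
      (CliffordAlgebra.even q).toSubmodule.baseChange R := ha.1
    change cliffordMap φ q a ∈ (CliffordAlgebra.even q).toSubmodule.baseChange S
    rw [Submodule.baseChange_eq_span] at hx' ⊢
    have hsm : ∀ (r : R) x, cliffordMap φ q (r • x) = φ r • cliffordMap φ q x := by
      intro r x
      exact scalarMap_smul φ r x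
    generalize (a : R ⊗[F] CliffordAlgebra q) = x at hx'
    induction hx' using Submodule.span_induction with
    | zero => simp
    | add x y _ _ h h' => rw [map_add]; exact add_mem h h'
    | smul r x _ h => rw [hsm]; exact Submodule.smul_mem _ _ h
    | mem x h =>
      obtain ⟨c, hc, rfl⟩ := h
      exact Submodule.subset_span ⟨c, hc, by simp [cliffordMap]⟩
  · change cliffordMap φ q a * tauExt q S (cliffordMap φ q a) = 1
    rw [htau, ← map_mul, ha.2.1, map_one]
  · apply Set.Subset.antisymm
    · rintro _ ⟨_, ⟨y, rfl⟩, rfl⟩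
      exact hconj a ha y
    · rintro _ ⟨y, rfl⟩
      obtain ⟨z, hz⟩ := hconj a⁻¹ (inv_mem ha) y
      refine ⟨_, ⟨z, rfl⟩, ?_⟩
      change cliffordMap φ q a * iotaExt q S z *
        cliffordMap φ q ((a⁻¹ : (R ⊗[F] CliffordAlgebra q)ˣ) : R ⊗[F] CliffordAlgebra q) = _
      rw [hz, inv_inv]
      have e : cliffordMap φ q a *
        cliffordMap φ q ((a⁻¹ : (R ⊗[F] CliffordAlgebra q)ˣ) : R ⊗[F] CliffordAlgebra q) = 1 := by
        rw [← map_mul, Units.mul_inv, map_one]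
      rw [← mul_assoc, ← mul_assoc, e, one_mul, mul_assoc, e, mul_one]

/-- The spin group scheme of a quadratic space `(V, q)`, as the functor that sends a commutative
`F`-algebra `R` to the group of its `R`-points. -/
def spinScheme (q : QuadraticForm F V) : CommAlgCat.{max u v, u} F ⥤ GrpCat.{max u v} where
  obj R := GrpCat.of (spin q R)
  map {R S} φ := GrpCat.ofHom
    (((Units.map (cliffordMap φ.hom q :
        R ⊗[F] CliffordAlgebra q →* S ⊗[F] CliffordAlgebra q)).comp
      (spin q R).subtype).codRestrict (spin q S) fun a => spin_map φ.hom q a.2)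
  map_id R := by
    ext a
    change cliffordMap (AlgHom.id F R) q _ = _
    rw [cliffordMap, Algebra.TensorProduct.map_id]
    rfl
  map_comp {R S T} φ ψ := by
    ext a
    change cliffordMap (ψ.hom.comp φ.hom) q _ = cliffordMap ψ.hom q (cliffordMap φ.hom q _)
    rw [cliffordMap, cliffordMap, cliffordMap, ← AlgHom.comp_apply,
      ← Algebra.TensorProduct.map_comp, AlgHom.comp_id]

end Spin

section Cayley

variable {F : Type u} [Field F] {C : Type v} [NonAssocRing C] [Module F C]

/-- `(C, n)` is a Cayley algebra over `F`: a unital (not necessarily associative) algebra of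
dimension `8` with a nondegenerate multiplicative quadratic form `n`, its norm. -/
structure IsCayley [SMulCommClass F C C] [IsScalarTower F C C] (n : QuadraticForm F C) :
    Prop where
  finrank_eq : Module.finrank F C = 8
  nondegenerate : (QuadraticMap.polarBilin n).Nondegenerate
  map_mul : ∀ x y, n (x * y) = n x * n y

/-- The canonical involution `x ↦ n(x, 1) 1 - x`, where `n(x, y) = n(x + y) - n(x) - n(y)`. -/
def bar (n : QuadraticForm F C) : C →ₗ[F] C :=
  ((QuadraticMap.polarBilin n).flip 1).smulRight 1 - LinearMap.id

theorem bar_apply (n : QuadraticForm F C) (x : C) :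
    bar n x = QuadraticMap.polar n x 1 • (1 : C) - x := by
  simp [bar]

/-- The subspace `C₀` of elements orthogonal to the unity. -/
def traceZero (n : QuadraticForm F C) : Submodule F C :=
  LinearMap.ker ((QuadraticMap.polarBilin n).flip 1)

/-- The quadratic form `-n` on `C₀`. -/
def negNorm (n : QuadraticForm F C) : QuadraticForm F (traceZero n) :=
  -(n.comp (traceZero n).subtype)

variable [SMulCommClass F C C] [IsScalarTower F C C]

/-- The para-Cayley product `x • y = x̄ ȳ` on `C_R`. -/
def para (n : QuadraticForm F C) (R : Type w) [CommRing R] [Algebra F R] (x y : R ⊗[F] C) :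
    R ⊗[F] C :=
  (bar n).baseChange R x * (bar n).baseChange R y

/-- Left multiplication `l_x : y ↦ x̄ ȳ` in the para-Cayley algebra of `C`, as a linear function
of `x`. -/
def paraLeft (n : QuadraticForm F C) : C →ₗ[F] Module.End F C :=
  (LinearMap.mul F C).compl₁₂ (bar n) (bar n)

/-- Right multiplication `r_x : y ↦ ȳ x̄` in the para-Cayley algebra of `C`, as a linear function
of `x`. -/
def paraRight (n : QuadraticForm F C) : C →ₗ[F] Module.End F C :=
  (paraLeft n).flip

theorem paraLeft_apply (n : QuadraticForm F C) (x y : C) : paraLeft n x y = bar n x * bar n y :=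
  rfl

theorem paraRight_apply (n : QuadraticForm F C) (x y : C) :
    paraRight n x y = bar n y * bar n x :=
  rfl

namespace IsCayley

variable {n : QuadraticForm F C}

theorem finite (h : IsCayley n) : Module.Finite F C :=
  Module.finite_of_finrank_pos (by rw [h.finrank_eq]; norm_num)

theorem eq_of_polar (h : IsCayley n) {x y : C}
    (hxy : ∀ z, QuadraticMap.polar n x z = QuadraticMap.polar n y z) : x = y := by
  rw [← sub_eq_zero]
  refine h.nondegenerate.1 _ fun z => ?_
  rw [map_sub, LinearMap.sub_apply, QuadraticMap.polarBilin_apply_apply,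
    QuadraticMap.polarBilin_apply_apply, hxy, sub_self]

theorem norm_one (h : IsCayley n) : n 1 = 1 := by
  have hC : Nontrivial C := Module.nontrivial_of_finrank_pos (R := F)
    (by rw [h.finrank_eq]; norm_num)
  have h1 : ∀ x, n x = n 1 * n x := fun x => by rw [← h.map_mul, one_mul]
  by_contra h2
  have h3 : ∀ x, n x = 0 := fun x => by
    have h4 : (n 1 - 1) * n x = 0 := by rw [sub_mul, ← h1, one_mul, sub_self]
    exact (mul_eq_zero.1 h4).resolve_left (sub_ne_zero.2 h2)
  exact one_ne_zero (h.eq_of_polar (x := (1 : C)) (y := 0) fun z => by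
    simp [QuadraticMap.polar, h3])

theorem polar_mul_left (h : IsCayley n) (x y z : C) :
    QuadraticMap.polar n (x * y) (x * z) = n x * QuadraticMap.polar n y z := by
  simp only [QuadraticMap.polar, ← mul_add, h.map_mul, mul_sub]

theorem polar_mul_right (h : IsCayley n) (x y z : C) :
    QuadraticMap.polar n (y * x) (z * x) = QuadraticMap.polar n y z * n x := by
  simp only [QuadraticMap.polar, ← add_mul, h.map_mul, sub_mul]

theorem polar_mul_add (h : IsCayley n) (x y z w : C) :
    QuadraticMap.polar n (x * y) (z * w) + QuadraticMap.polar n (z * y) (x * w) =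
      QuadraticMap.polar n x z * QuadraticMap.polar n y w := by
  have h1 := h.polar_mul_left (x + z) y w
  simp only [add_mul, QuadraticMap.polar_add_left, QuadraticMap.polar_add_right,
    h.polar_mul_left] at h1
  have h2 : n (x + z) = QuadraticMap.polar n x z + n x + n z := by
    simp only [QuadraticMap.polar]; ring
  rw [h2] at h1
  linear_combination h1

theorem polar_adj_left (h : IsCayley n) (x y z : C) :
    QuadraticMap.polar n (x * y) z = QuadraticMap.polar n y (bar n x * z) := by
  have h1 := h.polar_mul_add x y 1 z
  rw [one_mul, one_mul] at h1
  rw [bar_apply, sub_mul, smul_mul_assoc, one_mul, QuadraticMap.polar_sub_right,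
    QuadraticMap.polar_smul_right, smul_eq_mul]
  linear_combination h1

theorem polar_adj_right (h : IsCayley n) (x y z : C) :
    QuadraticMap.polar n (x * y) z = QuadraticMap.polar n x (z * bar n y) := by
  have h1 := h.polar_mul_add x y z 1
  rw [mul_one, mul_one, QuadraticMap.polar_comm n (z * y) x] at h1
  rw [bar_apply, mul_sub, mul_smul_comm, mul_one, QuadraticMap.polar_sub_right,
    QuadraticMap.polar_smul_right, smul_eq_mul]
  linear_combination h1

theorem polar_bar (_h : IsCayley n) (x y : C) :
    QuadraticMap.polar n (bar n x) y = QuadraticMap.polar n x (bar n y) := by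
  simp only [bar_apply, QuadraticMap.polar_sub_left, QuadraticMap.polar_sub_right,
    QuadraticMap.polar_smul_left, QuadraticMap.polar_smul_right, smul_eq_mul,
    QuadraticMap.polar_comm n 1 y]
  ring

theorem bar_bar (h : IsCayley n) (x : C) : bar n (bar n x) = x := by
  have h1 : QuadraticMap.polar n (1 : C) 1 = 2 := by
    rw [QuadraticMap.polar_self, h.norm_one]; simp
  rw [bar_apply, bar_apply, QuadraticMap.polar_sub_left, QuadraticMap.polar_smul_left, h1]
  rw [smul_eq_mul, mul_two, add_sub_cancel_right, sub_sub_cancel]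

theorem norm_bar (h : IsCayley n) (x : C) : n (bar n x) = n x := by
  have h2 : n (bar n x) = (QuadraticMap.polar n x 1) ^ 2 * n 1 -
      (QuadraticMap.polar n x 1) * QuadraticMap.polar n x 1 + n x := by
    have := QuadraticMap.map_add n (QuadraticMap.polar n x 1 • (1 : C)) (-x)
    rw [← sub_eq_add_neg, ← bar_apply, QuadraticMap.polar_neg_right,
      QuadraticMap.polar_smul_left, QuadraticMap.map_smul, QuadraticMap.map_neg,
      QuadraticMap.polar_comm n 1 x, smul_eq_mul, smul_eq_mul] at this
    rw [this]; ring
  rw [h2, h.norm_one]; ring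

theorem bar_mul (h : IsCayley n) (x y : C) : bar n (x * y) = bar n y * bar n x := by
  refine h.eq_of_polar fun z => ?_
  have e1 := h.polar_adj_left (bar n y) (bar n x) z
  have e2 := h.polar_adj_right (bar n x) (bar n z) y
  have e3 := h.polar_adj_left (bar n x) (bar n z) y
  rw [h.bar_bar] at e1 e2 e3
  rw [e1, h.polar_bar, ← h.polar_bar, h.polar_bar, ← e2, e3, QuadraticMap.polar_comm]

theorem paraLeft_paraRight (h : IsCayley n) (x y : C) :
    paraLeft n x (paraRight n x y) = n x • y := by
  refine h.eq_of_polar fun z => ?_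
  rw [paraLeft_apply, paraRight_apply, h.bar_mul, h.bar_bar, h.bar_bar, h.polar_adj_left,
    h.bar_bar, h.polar_mul_left, QuadraticMap.polar_smul_left, smul_eq_mul]

theorem paraRight_paraLeft (h : IsCayley n) (x y : C) :
    paraRight n x (paraLeft n x y) = n x • y := by
  refine h.eq_of_polar fun z => ?_
  rw [paraRight_apply, paraLeft_apply, h.bar_mul, h.bar_bar, h.bar_bar, h.polar_adj_right,
    h.bar_bar, h.polar_mul_right, QuadraticMap.polar_smul_left, smul_eq_mul, mul_comm]

end IsCayley

/-- The linear map that sends `x` to the block matrix with rows `(0, l_x)` and `(r_x, 0)`, acting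
on columns `(a, b)` with `a, b ∈ C`. -/
def paraMatrix (n : QuadraticForm F C) : C →ₗ[F] Module.End F (C × C) where
  toFun x := LinearMap.prod (paraLeft n x ∘ₗ LinearMap.snd F C C)
    (paraRight n x ∘ₗ LinearMap.fst F C C)
  map_add' x y := by ext <;> simp
  map_smul' a x := by ext <;> simp

theorem IsCayley.paraMatrix_mul_self {n : QuadraticForm F C} (h : IsCayley n) (x : C) :
    paraMatrix n x * paraMatrix n x = algebraMap F (Module.End F (C × C)) (n x) := by
  refine LinearMap.ext fun p => Prod.ext ?_ ?_
  · exact h.paraLeft_paraRight x p.1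
  · exact h.paraRight_paraLeft x p.2

/-- The representation `Φ : Cl(C, n) → End(C ⊕ C)` of the Clifford algebra induced by
`paraMatrix`. -/
def cliffordRep {n : QuadraticForm F C} (h : IsCayley n) :
    CliffordAlgebra n →ₐ[F] Module.End F (C × C) :=
  CliffordAlgebra.lift n ⟨paraMatrix n, h.paraMatrix_mul_self⟩

/-- The upper left block of `Φ(u)`. -/
def blockMinus {n : QuadraticForm F C} (h : IsCayley n) :
    CliffordAlgebra n →ₗ[F] Module.End F C where
  toFun u := LinearMap.fst F C C ∘ₗ cliffordRep h u ∘ₗ LinearMap.inl F C C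
  map_add' x y := by ext; simp
  map_smul' a x := by ext; simp

/-- The lower right block of `Φ(u)`. -/
def blockPlus {n : QuadraticForm F C} (h : IsCayley n) :
    CliffordAlgebra n →ₗ[F] Module.End F C where
  toFun u := LinearMap.snd F C C ∘ₗ cliffordRep h u ∘ₗ LinearMap.inr F C C
  map_add' x y := by ext; simp
  map_smul' a x := by ext; simp

/-- The upper left block `ρ⁻_u` of `Φ_R(u)`, for `u ∈ Cl(C, n)_R`, as an endomorphism of `C_R`. -/
def rhoMinus {n : QuadraticForm F C} (h : IsCayley n) (R : Type w) [CommRing R] [Algebra F R] :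
    R ⊗[F] CliffordAlgebra n →ₗ[R] Module.End R (R ⊗[F] C) :=
  (LinearMap.tensorProductEnd F R C).toLinearMap ∘ₗ (blockMinus h).baseChange R

/-- The lower right block `ρ⁺_u` of `Φ_R(u)`, for `u ∈ Cl(C, n)_R`, as an endomorphism of `C_R`. -/
def rhoPlus {n : QuadraticForm F C} (h : IsCayley n) (R : Type w) [CommRing R] [Algebra F R] :
    R ⊗[F] CliffordAlgebra n →ₗ[R] Module.End R (R ⊗[F] C) :=
  (LinearMap.tensorProductEnd F R C).toLinearMap ∘ₗ (blockPlus h).baseChange R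

/-- The linear map `C₀ → Cl(C, n)`, `x ↦ e₀ · x`, where `e₀` is the unity of `C`. -/
def unityMul (n : QuadraticForm F C) : traceZero n →ₗ[F] CliffordAlgebra n :=
  LinearMap.mulLeft F (CliffordAlgebra.ι n 1) ∘ₗ CliffordAlgebra.ι n ∘ₗ (traceZero n).subtype

theorem IsCayley.unityMul_mul_self {n : QuadraticForm F C} (h : IsCayley n) (x : traceZero n) :
    unityMul n x * unityMul n x = algebraMap F (CliffordAlgebra n) (negNorm n x) := by
  have hx : QuadraticMap.polar n x 1 = 0 := x.2
  have h1 := CliffordAlgebra.ι_mul_ι_add_swap (Q := n) (x : C) 1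
  rw [hx, map_zero] at h1
  have h2 := eq_neg_of_add_eq_zero_left h1
  change CliffordAlgebra.ι n 1 * CliffordAlgebra.ι n x *
    (CliffordAlgebra.ι n 1 * CliffordAlgebra.ι n x) = algebraMap F _ (-(n x))
  rw [mul_assoc, ← mul_assoc (CliffordAlgebra.ι n (x : C)), h2, neg_mul, mul_neg, mul_assoc,
    CliffordAlgebra.ι_sq_scalar, ← mul_assoc, CliffordAlgebra.ι_sq_scalar, h.norm_one, map_one,
    one_mul, map_neg]

/-- The algebra homomorphism `Ψ : Cl(C₀, -n) → Cl(C, n)` with `Ψ(x) = e₀ · x` for `x ∈ C₀`. -/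
def cliffordEmb {n : QuadraticForm F C} (h : IsCayley n) :
    CliffordAlgebra (negNorm n) →ₐ[F] CliffordAlgebra n :=
  CliffordAlgebra.lift (negNorm n) ⟨unityMul n, h.unityMul_mul_self⟩

/-- The scalar extension `Ψ_R : Cl(C₀, -n)_R → Cl(C, n)_R` of `Ψ`. -/
def cliffordEmbExt {n : QuadraticForm F C} (h : IsCayley n) (R : Type w) [CommRing R]
    [Algebra F R] : R ⊗[F] CliffordAlgebra (negNorm n) →ₐ[R] R ⊗[F] CliffordAlgebra n :=
  Algebra.TensorProduct.map (AlgHom.id R R) (cliffordEmb h)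

variable {R : Type w} [CommRing R] [Algebra F R] {S : Type w'} [CommRing S] [Algebra F S]

theorem scalarMap_para (n : QuadraticForm F C) (φ : R →ₐ[F] S) (x y : R ⊗[F] C) :
    scalarMap φ C (para n R x y) = para n S (scalarMap φ C x) (scalarMap φ C y) := by
  unfold para
  induction x using TensorProduct.induction_on with
  | zero => simp
  | add x x' hx hx' => simp only [map_add, add_mul, hx, hx']
  | tmul r c =>
    induction y using TensorProduct.induction_on with
    | zero => simp
    | add x x' hx hx' => simp only [map_add, mul_add, hx, hx']
    | tmul s d => simp

/-- The para-Cayley product as an `S`-bilinear map. -/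
def paraBilin (n : QuadraticForm F C) (S : Type w) [CommRing S] [Algebra F S] :
    S ⊗[F] C →ₗ[S] S ⊗[F] C →ₗ[S] S ⊗[F] C :=
  (LinearMap.mul S (S ⊗[F] C)).compl₁₂ ((bar n).baseChange S) ((bar n).baseChange S)

end Cayley

section TripleMap

variable {F : Type u} [Field F] {C : Type v} [AddCommGroup C] [Module F C]

/-- The group `GL(C)(R)³`, with componentwise multiplication. -/
abbrev GLTriple (F : Type u) [Field F] (C : Type v) [AddCommGroup C] [Module F C] (R : Type w)
    [CommRing R] [Algebra F R] : Type max w v :=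
  LinearMap.GeneralLinearGroup R (R ⊗[F] C) × LinearMap.GeneralLinearGroup R (R ⊗[F] C) ×
    LinearMap.GeneralLinearGroup R (R ⊗[F] C)

variable {R : Type w} [CommRing R] [Algebra F R] {S : Type w'} [CommRing S] [Algebra F S]

/-- The homomorphism `GL(C)(R)³ → GL(C)(S)³` induced by `φ : R → S`. -/
def tripleMap (φ : R →ₐ[F] S) (C : Type v) [AddCommGroup C] [Module F C] :
    GLTriple F C R →* GLTriple F C S :=
  (Units.map (endMap φ C)).prodMap
    ((Units.map (endMap φ C)).prodMap (Units.map (endMap φ C)))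

theorem tripleMap_id (f : GLTriple F C R) : tripleMap (AlgHom.id F R) C f = f := by
  have e : ∀ g : Module.End R (R ⊗[F] C), endMap (AlgHom.id F R) C g = g := fun g =>
    linearMap_ext_scalarMap (AlgHom.id F R) fun x => by
      rw [endMap_scalarMap]; simp [scalarMap]
  exact Prod.ext (Units.ext (e _)) (Prod.ext (Units.ext (e _)) (Units.ext (e _)))

theorem tripleMap_comp {T : Type*} [CommRing T] [Algebra F T] (φ : R →ₐ[F] S) (ψ : S →ₐ[F] T)
    (f : GLTriple F C R) :
    tripleMap (ψ.comp φ) C f = tripleMap ψ C (tripleMap φ C f) := by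
  have e : ∀ g : Module.End R (R ⊗[F] C),
      endMap (ψ.comp φ) C g = endMap ψ C (endMap φ C g) := fun g =>
    linearMap_ext_scalarMap (ψ.comp φ) fun x => by
      have hc : ∀ z, scalarMap (ψ.comp φ) C z = scalarMap ψ C (scalarMap φ C z) := fun z => by
        simp only [scalarMap, AlgHom.comp_toLinearMap, LinearMap.rTensor_comp_apply]
      rw [endMap_scalarMap, hc, hc, endMap_scalarMap, endMap_scalarMap]
  exact Prod.ext (Units.ext (e _)) (Prod.ext (Units.ext (e _)) (Units.ext (e _)))

end TripleMap

section Triples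

variable {F : Type u} [Field F] [Invertible (2 : F)]
variable {C : Type v} [NonAssocRing C] [Module F C] [SMulCommClass F C C] [IsScalarTower F C C]

/-- The group of `R`-points of the scheme of related triples: the `(f₀, f₁, f₂) ∈ O⁺(C, n)(R)³`
with `f₀(x • y) = f₁(x) • f₂(y)` for all `x, y ∈ C_R`. -/
def relatedTriples (n : QuadraticForm F C) (R : Type w) [CommRing R] [Algebra F R] :
    Subgroup (GLTriple F C R) where
  carrier := {f | f.1 ∈ specialOrthogonal n R ∧ f.2.1 ∈ specialOrthogonal n R ∧
    f.2.2 ∈ specialOrthogonal n R ∧ ∀ x y : R ⊗[F] C,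
      (f.1 : Module.End R (R ⊗[F] C)) (para n R x y) =
        para n R ((f.2.1 : Module.End R (R ⊗[F] C)) x) ((f.2.2 : Module.End R (R ⊗[F] C)) y)}
  one_mem' := ⟨one_mem _, one_mem _, one_mem _, fun _ _ => rfl⟩
  mul_mem' := by
    rintro f g ⟨h0, h1, h2, h⟩ ⟨k0, k1, k2, k⟩
    refine ⟨mul_mem h0 k0, mul_mem h1 k1, mul_mem h2 k2, fun x y => ?_⟩
    simp [h, k]
  inv_mem' := by
    rintro f ⟨h0, h1, h2, h⟩
    refine ⟨inv_mem h0, inv_mem h1, inv_mem h2, fun x y => ?_⟩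
    have e : ∀ (g : LinearMap.GeneralLinearGroup R (R ⊗[F] C)) (z : R ⊗[F] C),
        (g : Module.End R (R ⊗[F] C))
          (((g⁻¹ : LinearMap.GeneralLinearGroup R (R ⊗[F] C)) : Module.End R (R ⊗[F] C)) z) = z :=
      fun g z => by rw [← Module.End.mul_apply, Units.mul_inv, Module.End.one_apply]
    have e' : ∀ (g : LinearMap.GeneralLinearGroup R (R ⊗[F] C)) (z : R ⊗[F] C),
        ((g⁻¹ : LinearMap.GeneralLinearGroup R (R ⊗[F] C)) : Module.End R (R ⊗[F] C))
          ((g : Module.End R (R ⊗[F] C)) z) = z :=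
      fun g z => by rw [← Module.End.mul_apply, Units.inv_mul, Module.End.one_apply]
    have h3 := h (((f.2.1⁻¹ : LinearMap.GeneralLinearGroup R (R ⊗[F] C)) :
      Module.End R (R ⊗[F] C)) x) (((f.2.2⁻¹ : LinearMap.GeneralLinearGroup R (R ⊗[F] C)) :
      Module.End R (R ⊗[F] C)) y)
    rw [e, e] at h3
    change ((f.1⁻¹ : LinearMap.GeneralLinearGroup R (R ⊗[F] C)) : Module.End R (R ⊗[F] C)) _ = _
    rw [← h3, e']
    rfl

/-- The group of `R`-points of the scheme of related triples `(f₀, f₁, f₂)` with `f₀(e₀) = e₀`,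
where `e₀` is the unity of `C`. -/
def unityTriples (n : QuadraticForm F C) (R : Type w) [CommRing R] [Algebra F R] :
    Subgroup (GLTriple F C R) where
  carrier := {f | f ∈ relatedTriples n R ∧
    (f.1 : Module.End R (R ⊗[F] C)) (1 ⊗ₜ[F] (1 : C)) = 1 ⊗ₜ[F] (1 : C)}
  one_mem' := ⟨one_mem _, rfl⟩
  mul_mem' := by
    rintro f g ⟨hf, hf'⟩ ⟨hg, hg'⟩
    exact ⟨mul_mem hf hg, by simp [hf', hg']⟩
  inv_mem' := by
    rintro f ⟨hf, hf'⟩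
    refine ⟨inv_mem hf, ?_⟩
    conv_lhs => rw [← hf']
    rw [← Module.End.mul_apply]
    change (((f.1⁻¹ * f.1 : LinearMap.GeneralLinearGroup R (R ⊗[F] C))) :
      Module.End R (R ⊗[F] C)) _ = _
    rw [inv_mul_cancel]
    rfl

variable {R : Type w} [CommRing R] [Algebra F R] {S : Type w'} [CommRing S] [Algebra F S]

theorem relatedTriples_map {n : QuadraticForm F C} (h : IsCayley n) (φ : R →ₐ[F] S)
    {f : GLTriple F C R} (hf : f ∈ relatedTriples n R) :
    tripleMap φ C f ∈ relatedTriples n S := by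
  have hfin := h.finite
  obtain ⟨h0, h1, h2, hf⟩ := hf
  refine ⟨specialOrthogonal_map n φ h0, specialOrthogonal_map n φ h1,
    specialOrthogonal_map n φ h2, ?_⟩
  have key : (paraBilin n S).compr₂ (endMap φ C f.1) =
      (paraBilin n S).compl₁₂ (endMap φ C f.2.1) (endMap φ C f.2.2) := by
    refine linearMap_ext_scalarMap φ fun x => linearMap_ext_scalarMap φ fun y => ?_
    change endMap φ C f.1 (para n S (scalarMap φ C x) (scalarMap φ C y)) =
      para n S (endMap φ C f.2.1 (scalarMap φ C x)) (endMap φ C f.2.2 (scalarMap φ C y))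
    rw [← scalarMap_para, endMap_scalarMap, endMap_scalarMap, endMap_scalarMap, hf, scalarMap_para]
  exact fun x y => LinearMap.congr_fun₂ key x y

theorem unityTriples_map {n : QuadraticForm F C} (h : IsCayley n) (φ : R →ₐ[F] S)
    {f : GLTriple F C R} (hf : f ∈ unityTriples n R) :
    tripleMap φ C f ∈ unityTriples n S := by
  refine ⟨relatedTriples_map h φ hf.1, ?_⟩
  have h1 := congrArg (scalarMap φ C) hf.2
  rw [← endMap_scalarMap, scalarMap_tmul, map_one] at h1
  exact h1

/-- The homomorphism from the `R`-points to the `S`-points of the scheme of related triples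
that is induced by `φ : R → S`. -/
def relatedTriplesHom {n : QuadraticForm F C} (h : IsCayley n) (φ : R →ₐ[F] S) :
    relatedTriples n R →* relatedTriples n S :=
  ((tripleMap φ C).comp (relatedTriples n R).subtype).codRestrict (relatedTriples n S)
    fun f => relatedTriples_map h φ f.2

/-- The affine group scheme of related triples
`{(f₀, f₁, f₂) ∈ O⁺(C, n)³ | f₀(x • y) = f₁(x) • f₂(y)}`. -/
def relatedTripleScheme {n : QuadraticForm F C} (h : IsCayley n) :
    CommAlgCat.{max u v, u} F ⥤ GrpCat.{max u v} where
  obj R := GrpCat.of (relatedTriples n R)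
  map φ := GrpCat.ofHom (relatedTriplesHom h φ.hom)
  map_id R := GrpCat.ext fun (f : relatedTriples n R) => Subtype.ext (tripleMap_id f.1)
  map_comp {R _ _} φ ψ := GrpCat.ext fun (f : relatedTriples n R) =>
    Subtype.ext (tripleMap_comp φ.hom ψ.hom f.1)

/-- The homomorphism from the `R`-points to the `S`-points of the scheme of related triples that fix `e₀`
that is induced by `φ : R → S`. -/
def unityTriplesHom {n : QuadraticForm F C} (h : IsCayley n) (φ : R →ₐ[F] S) :
    unityTriples n R →* unityTriples n S :=
  ((tripleMap φ C).comp (unityTriples n R).subtype).codRestrict (unityTriples n S)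
    fun f => unityTriples_map h φ f.2

/-- The affine group scheme of related triples `(f₀, f₁, f₂)` with `f₀(e₀) = e₀`. -/
def unityTripleScheme {n : QuadraticForm F C} (h : IsCayley n) :
    CommAlgCat.{max u v, u} F ⥤ GrpCat.{max u v} where
  obj R := GrpCat.of (unityTriples n R)
  map φ := GrpCat.ofHom (unityTriplesHom h φ.hom)
  map_id R := GrpCat.ext fun (f : unityTriples n R) => Subtype.ext (tripleMap_id f.1)
  map_comp {R _ _} φ ψ := GrpCat.ext fun (f : unityTriples n R) =>
    Subtype.ext (tripleMap_comp φ.hom ψ.hom f.1)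

/-- The inclusion of the scheme of related triples that fix `e₀` in that of related triples. -/
def unityTripleIncl {n : QuadraticForm F C} (h : IsCayley n) :
    unityTripleScheme h ⟶ relatedTripleScheme h where
  app R := GrpCat.ofHom (Subgroup.inclusion fun _ hf => hf.1)

/-- `f = (χ_u, ρ⁺_u, ρ⁻_u)`, where `χ_u` is the vector representation: `χ_u(x) = u · x · u⁻¹` in
the Clifford algebra, for all `x ∈ C_R`. -/
def IsTrialityTriple {n : QuadraticForm F C} (h : IsCayley n) {R : Type w} [CommRing R]
    [Algebra F R] (u : spin n R) (f : relatedTriples n R) : Prop :=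
  (∀ x : R ⊗[F] C, iotaExt n R ((f.1.1 : Module.End R (R ⊗[F] C)) x) =
      ((u : (R ⊗[F] CliffordAlgebra n)ˣ) : R ⊗[F] CliffordAlgebra n) * iotaExt n R x *
        (((u : (R ⊗[F] CliffordAlgebra n)ˣ)⁻¹ : (R ⊗[F] CliffordAlgebra n)ˣ) :
          R ⊗[F] CliffordAlgebra n)) ∧
    (f.1.2.1 : Module.End R (R ⊗[F] C)) = rhoPlus h R u.1 ∧
    (f.1.2.2 : Module.End R (R ⊗[F] C)) = rhoMinus h R u.1

/-- `v = Ψ_R(u)`. -/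
def IsCliffordImage {n : QuadraticForm F C} (h : IsCayley n) {R : Type w} [CommRing R]
    [Algebra F R] (u : spin (negNorm n) R) (v : spin n R) : Prop :=
  ((v : (R ⊗[F] CliffordAlgebra n)ˣ) : R ⊗[F] CliffordAlgebra n) =
    cliffordEmbExt h R ((u : (R ⊗[F] CliffordAlgebra (negNorm n))ˣ) :
      R ⊗[F] CliffordAlgebra (negNorm n))

end Triples

end SpinTriality

end

noncomputable section

namespace SpinTriality

/-! ### Contractions and spans of products of orthogonal vectors -/

section Filtration

open CliffordAlgebra

variable {F : Type*} [CommRing F] {V : Type*} [AddCommGroup V] [Module F V]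
variable (Q : QuadraticForm F V)

/-! The heart of the matter is that Φ (`cliffordRep`) is an isomorphism of Cl(C, n) onto End(C ⊕ C),
and remains one over every R. Its kernel is a two-sided ideal, stable under the grade involution
because Φ turns that involution into conjugation by (a, b) ↦ (a, -b). The supercommutator with a
vector v is the contraction with n(v, ·), so the kernel is stable under these contractions.
Contracting a nonzero element along an orthogonal basis would leave a nonzero scalar, and 1 is not
in the kernel; hence Φ is injective. The dimensions 2^8 and 16^2 agree.

Through Φ_R, even elements become block-diagonal operators and τ becomes the adjoint for n ⊥ n. An
even u with u · τ(u) = 1 is therefore a pair of isometries (ρ⁻, ρ⁺), and u · x = χ_u(x) · u, read on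
the two blocks, says ρ⁺(x • y) = ρ⁻(x) • χ_u(y) and ρ⁻(x • y) = χ_u(x) • ρ⁺(y). Because n(x • y, z)
= n(x, y • z), such relations between isometries can be permuted cyclically (`Related.rotate`). This
gives the related triple of u (`related_trialityTriple`); conversely, the blocks f₂, f₁ of a related
triple define a spin element u with χ_u = f₀ (`exists_spin_of_related`).

Determinant one is automatic. Conjugation by u multiplies the product of an orthogonal basis by det
χ_u, yet in even dimension that product commutes with even elements, so det χ_u = 1 (`det_chi`).
Every related triple of isometries comes from some u, and rotation brings each member into the place
of χ_u.

For the second isomorphism, Ψ identifies Cl(C₀, -n) with the even part of Cl(C, n), and conjugation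
by e₀ there is the grade involution of Cl(C₀, -n). So a is even exactly when Ψ(a) commutes with e₀,
which for a spin element Ψ(a) means that χ fixes e₀ (`exists_spinEmb_eq`). Naturality in R holds
because u determines its triple by equations that survive base change. -/

theorem ι_mul_sub_involute_mul_ι (v : V) (x : CliffordAlgebra Q) :
    ι Q v * x - involute x * ι Q v = contractLeft (QuadraticMap.polarBilin Q v) x := by
  induction x using CliffordAlgebra.left_induction with
  | algebraMap r => simp [Algebra.commutes]
  | add x y hx hy => rw [map_add, map_add, ← hx, ← hy]; noncomm_ring
  | ι_mul x m hx =>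
    rw [contractLeft_ι_mul, ← hx, map_mul, involute_ι, QuadraticMap.polarBilin_apply_apply,
      Algebra.smul_def, ← ι_mul_ι_add_swap]
    noncomm_ring

/-- The span of the products of subfamilies of a list of vectors. -/
def productSpan : List V → Submodule F (CliffordAlgebra Q)
  | [] => 1
  | v :: l => productSpan l ⊔ (productSpan l).map (LinearMap.mulLeft F (ι Q v))

variable {Q}

theorem mem_productSpan_cons {v : V} {l : List V} {x : CliffordAlgebra Q} :
    x ∈ productSpan Q (v :: l) ↔
      ∃ a ∈ productSpan Q l, ∃ b ∈ productSpan Q l, a + ι Q v * b = x := by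
  simp [productSpan, Submodule.mem_sup]

theorem one_mem_productSpan (l : List V) : (1 : CliffordAlgebra Q) ∈ productSpan Q l := by
  induction l with
  | nil => exact Submodule.one_le.1 le_rfl
  | cons v l ih => exact mem_productSpan_cons.2 ⟨1, ih, 0, zero_mem _, by simp⟩

theorem ι_mul_ι_of_polar_eq_zero {v w : V} (h : QuadraticMap.polar Q v w = 0) :
    ι Q v * ι Q w = -(ι Q w * ι Q v) := by
  have h1 := ι_mul_ι_add_swap (Q := Q) v w
  rw [h, map_zero] at h1
  exact eq_neg_of_add_eq_zero_left h1

/-- Moving v to its own place in the list costs only signs, and there v · v is a scalar. -/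
theorem ι_mul_mem_productSpan {l : List V} (hl : l.Pairwise fun v w => QuadraticMap.polar Q v w = 0)
    {v : V} (hv : v ∈ l) {x : CliffordAlgebra Q} (hx : x ∈ productSpan Q l) :
    ι Q v * x ∈ productSpan Q l := by
  induction l generalizing x with
  | nil => simp at hv
  | cons w l ih =>
    obtain ⟨hw, hl⟩ := List.pairwise_cons.1 hl
    obtain ⟨a, ha, b, hb, rfl⟩ := mem_productSpan_cons.1 hx
    rcases List.mem_cons.1 hv with rfl | hv
    · refine mem_productSpan_cons.2 ⟨Q v • b, Submodule.smul_mem _ _ hb, a, ha, ?_⟩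
      rw [mul_add, ← mul_assoc, ι_sq_scalar, Algebra.smul_def, add_comm]
    · refine mem_productSpan_cons.2 ⟨ι Q v * a, ih hl hv ha, -(ι Q v * b),
        neg_mem (ih hl hv hb), ?_⟩
      rw [mul_add, ← mul_assoc (ι Q v) (ι Q w), eq_neg_iff_add_eq_zero.2
        ((add_comm _ _).trans (eq_neg_iff_add_eq_zero.1 (ι_mul_ι_of_polar_eq_zero (hw v hv)))),
        mul_neg, neg_mul, mul_assoc]

/-- The span contains 1 and is closed under left multiplication by all vectors. -/
theorem productSpan_eq_top {l : List V} (hl : l.Pairwise fun v w => QuadraticMap.polar Q v w = 0)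
    (hs : Submodule.span F {v | v ∈ l} = ⊤) : productSpan Q l = ⊤ := by
  refine Submodule.eq_top_iff'.2 fun x => ?_
  induction x using CliffordAlgebra.left_induction with
  | algebraMap r =>
    rw [Algebra.algebraMap_eq_smul_one]
    exact Submodule.smul_mem _ _ (one_mem_productSpan l)
  | add x y hx hy => exact add_mem hx hy
  | ι_mul x m hx =>
    have hm : m ∈ Submodule.span F {v | v ∈ l} := hs ▸ Submodule.mem_top
    induction hm using Submodule.span_induction with
    | mem v hv => exact ι_mul_mem_productSpan hl hv hx
    | zero => simp
    | add v w _ _ h h' => rw [map_add, add_mul]; exact add_mem h h'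
    | smul a v _ h => rw [map_smul, smul_mul_assoc]; exact Submodule.smul_mem _ _ h

theorem contractLeft_eq_zero_of_mem_productSpan {l : List V} {d : Module.Dual F V}
    (hd : ∀ v ∈ l, d v = 0) {x : CliffordAlgebra Q} (hx : x ∈ productSpan Q l) :
    contractLeft d x = 0 := by
  induction l generalizing x with
  | nil =>
    obtain ⟨r, rfl⟩ := Submodule.mem_one.1 hx
    simp
  | cons w l ih =>
    obtain ⟨a, ha, b, hb, rfl⟩ := mem_productSpan_cons.1 hx
    have hd' : ∀ v ∈ l, d v = 0 := fun v hv => hd v (List.mem_cons_of_mem _ hv)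
    rw [map_add, contractLeft_ι_mul, ih hd' ha, ih hd' hb, hd w List.mem_cons_self]
    simp

/-- Contraction along v kills everything built from vectors orthogonal to v, so it recovers the
coefficient of v up to the factor 2 Q(v). Both the dimension count and the injectivity of Φ rest on
this. -/
theorem contractLeft_add_ι_mul {l : List V} {v : V}
    (hv : ∀ w ∈ l, QuadraticMap.polar Q v w = 0) {a b : CliffordAlgebra Q}
    (ha : a ∈ productSpan Q l) (hb : b ∈ productSpan Q l) :
    contractLeft (QuadraticMap.polarBilin Q v) (a + ι Q v * b) = (2 * Q v) • b := by
  rw [map_add, contractLeft_ι_mul, contractLeft_eq_zero_of_mem_productSpan hv ha,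
    contractLeft_eq_zero_of_mem_productSpan hv hb, QuadraticMap.polarBilin_apply_apply,
    QuadraticMap.polar_self]
  simp

theorem prod_mul_ι {l : List V} {v : V} (hv : ∀ w ∈ l, QuadraticMap.polar Q w v = 0) :
    (l.map (ι Q)).prod * ι Q v = (-1) ^ l.length * (ι Q v * (l.map (ι Q)).prod) := by
  induction l with
  | nil => simp
  | cons w l ih =>
    rw [List.map_cons, List.prod_cons, mul_assoc, ih fun u hu => hv u (List.mem_cons_of_mem _ hu),
      List.length_cons, pow_succ, ← mul_assoc (ι Q w), ← ((Commute.neg_one_left _).pow_left _).eq,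
      mul_assoc, ← mul_assoc (ι Q w), ι_mul_ι_of_polar_eq_zero (hv w List.mem_cons_self)]
    noncomm_ring

/-- Passing v through the product costs a sign at each member but v itself, one sign fewer than for
a vector orthogonal to the whole list. -/
theorem prod_mul_ι_of_mem {l : List V} (hl : l.Pairwise fun v w => QuadraticMap.polar Q v w = 0)
    {v : V} (hv : v ∈ l) :
    (l.map (ι Q)).prod * ι Q v = -((-1) ^ l.length * (ι Q v * (l.map (ι Q)).prod)) := by
  induction l with
  | nil => simp at hv
  | cons w l ih =>
    obtain ⟨hw, hl⟩ := List.pairwise_cons.1 hl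
    rw [List.map_cons, List.prod_cons, mul_assoc]
    rcases List.mem_cons.1 hv with rfl | hv
    · rw [prod_mul_ι fun u hu => QuadraticMap.polar_comm Q v u ▸ hw u hu, List.length_cons,
        pow_succ, ← mul_assoc (ι Q v), ← ((Commute.neg_one_left _).pow_left _).eq]
      noncomm_ring
    · rw [ih hl hv, List.length_cons, pow_succ, mul_neg, ← mul_assoc (ι Q w),
        ← ((Commute.neg_one_left _).pow_left _).eq, mul_assoc, ← mul_assoc (ι Q w),
        ι_mul_ι_of_polar_eq_zero (hw v hv)]
      noncomm_ring

/-- The product of an orthogonal basis of even length anticommutes with vectors. -/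
theorem prod_mul_eq_involute_mul_prod {l : List V}
    (hl : l.Pairwise fun v w => QuadraticMap.polar Q v w = 0)
    (hs : Submodule.span F {v | v ∈ l} = ⊤) (he : Even l.length) (x : CliffordAlgebra Q) :
    (l.map (ι Q)).prod * x = involute x * (l.map (ι Q)).prod := by
  have key : ∀ m, (l.map (ι Q)).prod * ι Q m = -(ι Q m * (l.map (ι Q)).prod) := by
    intro m
    have hm : m ∈ Submodule.span F {v | v ∈ l} := hs ▸ Submodule.mem_top
    induction hm using Submodule.span_induction with
    | mem v hv => rw [prod_mul_ι_of_mem hl hv, he.neg_one_pow, one_mul]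
    | zero => simp
    | add v w _ _ h h' => rw [map_add, mul_add, h, h']; noncomm_ring
    | smul a v _ h => rw [map_smul, mul_smul_comm, h, smul_mul_assoc, smul_neg]
  induction x using CliffordAlgebra.left_induction with
  | algebraMap r => simp [Algebra.commutes]
  | add x y hx hy => rw [mul_add, hx, hy, map_add, add_mul]
  | ι_mul x m hx =>
    rw [← mul_assoc, key, map_mul, involute_ι, neg_mul, neg_mul, mul_assoc, hx, neg_mul, mul_assoc]

theorem contractLeft_prod_ι_eq_zero {d : Module.Dual F V} {l : List V}
    (hd : ∀ v ∈ l, d v = 0) : contractLeft d (l.map (ι Q)).prod = 0 := by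
  induction l with
  | nil => simp
  | cons v l ih =>
    rw [List.map_cons, List.prod_cons, contractLeft_ι_mul, hd v List.mem_cons_self,
      ih fun w hw => hd w (List.mem_cons_of_mem _ hw)]
    simp

end Filtration

/-! ### Dimension of the Clifford algebra and subspaces stable under contraction -/

section Field

open CliffordAlgebra

variable {F : Type*} [Field F] [Invertible (2 : F)] {V : Type*} [AddCommGroup V] [Module F V]
variable {Q : QuadraticForm F V}

theorem finrank_productSpan {l : List V} (hl : l.Pairwise fun v w => QuadraticMap.polar Q v w = 0)
    (hQ : ∀ v ∈ l, Q v ≠ 0) :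
    Module.Finite F (productSpan Q l) ∧ Module.finrank F (productSpan Q l) = 2 ^ l.length := by
  induction l with
  | nil =>
    have e : productSpan Q [] = Submodule.span F {(1 : CliffordAlgebra Q)} :=
      Submodule.one_eq_span
    rw [e]
    exact ⟨Module.Finite.span_singleton F _, finrank_span_singleton one_ne_zero⟩
  | cons v l ih =>
    obtain ⟨hv, hl⟩ := List.pairwise_cons.1 hl
    obtain ⟨h1, h2⟩ := ih hl fun w hw => hQ w (List.mem_cons_of_mem _ hw)
    have hv0 : (2 * Q v : F) ≠ 0 := mul_ne_zero (Invertible.ne_zero 2) (hQ v List.mem_cons_self)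
    -- This serves twice: with a = 0 it makes left multiplication by v injective on the smaller
    -- span, and in general it makes the sum of the two summands direct, so the dimension doubles.
    have key : ∀ a ∈ productSpan Q l, ∀ b ∈ productSpan Q l, a + ι Q v * b = 0 → b = 0 := by
      intro a ha b hb hab
      have h3 := contractLeft_add_ι_mul hv ha hb
      rw [hab, map_zero] at h3
      exact (smul_eq_zero.1 h3.symm).resolve_left hv0
    have hf : Module.finrank F ((productSpan Q l).map (LinearMap.mulLeft F (ι Q v))) =
        2 ^ l.length := by
      rw [← h2]
      refine (LinearEquiv.finrank_eq (LinearEquiv.ofBijective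
        ((LinearMap.mulLeft F (ι Q v)).submoduleMap (productSpan Q l)) ⟨?_, ?_⟩)).symm
      · refine (injective_iff_map_eq_zero _).2 fun b hb => Subtype.ext ?_
        have hb' := congrArg Subtype.val hb
        exact key 0 (zero_mem _) b b.2 (by simpa using hb')
      · exact LinearMap.submoduleMap_surjective _ _
    have hinf : productSpan Q l ⊓ (productSpan Q l).map (LinearMap.mulLeft F (ι Q v)) = ⊥ := by
      refine (Submodule.eq_bot_iff _).2 ?_
      rintro _ ⟨ha, b, hb, rfl⟩
      have h4 := key _ (neg_mem ha) b hb (by simp)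
      simp [h4]
    refine ⟨Submodule.finite_sup _ _, ?_⟩
    have h5 := Submodule.finrank_sup_add_finrank_inf_eq (productSpan Q l)
      ((productSpan Q l).map (LinearMap.mulLeft F (ι Q v)))
    rw [hinf, finrank_bot, h2, hf] at h5
    change Module.finrank F ↥(productSpan Q l ⊔ _) = _
    rw [List.length_cons, pow_succ, mul_two]
    exact h5

/-- If a + v · b lies in K, contraction along v puts 2 Q(v) b in K, so b = 0 by induction and then a
= 0. At the empty list only scalars remain, and a nonzero scalar in K would give 1 ∈ K. -/
theorem inf_productSpan_eq_bot {K : Submodule F (CliffordAlgebra Q)}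
    (hK : ∀ v, ∀ x ∈ K, contractLeft (QuadraticMap.polarBilin Q v) x ∈ K) (h1 : 1 ∉ K)
    {l : List V} (hl : l.Pairwise fun v w => QuadraticMap.polar Q v w = 0)
    (hQ : ∀ v ∈ l, Q v ≠ 0) : ∀ x ∈ K, x ∈ productSpan Q l → x = 0 := by
  induction l with
  | nil =>
    intro x hx hx'
    obtain ⟨r, rfl⟩ := Submodule.mem_one.1 hx'
    by_contra hr
    have hr' : r ≠ 0 := fun h => hr (by rw [h, map_zero])
    refine h1 ?_
    have h2 := K.smul_mem r⁻¹ hx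
    rwa [Algebra.algebraMap_eq_smul_one, smul_smul, inv_mul_cancel₀ hr', one_smul] at h2
  | cons v l ih =>
    obtain ⟨hv, hl⟩ := List.pairwise_cons.1 hl
    have ih' := ih hl fun w hw => hQ w (List.mem_cons_of_mem _ hw)
    have hv0 : (2 * Q v : F) ≠ 0 := mul_ne_zero (Invertible.ne_zero 2) (hQ v List.mem_cons_self)
    intro x hx hx'
    obtain ⟨a, ha, b, hb, rfl⟩ := mem_productSpan_cons.1 hx'
    have h3 := hK v _ hx
    rw [contractLeft_add_ι_mul hv ha hb] at h3
    have hb0 := ih' b ((K.smul_mem_iff hv0).1 h3) hb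
    subst hb0
    rw [mul_zero, add_zero] at hx ⊢
    exact ih' a hx ha

/-- An orthogonal basis of a nondegenerate quadratic space, as a family indexed by `Fin N`. -/
theorem exists_orthogonal_basis_polar [Module.Finite F V]
    (hQ : (QuadraticMap.polarBilin Q).Nondegenerate) {N : ℕ} (hN : Module.finrank F V = N) :
    ∃ b : Module.Basis (Fin N) F V, (∀ i j, i ≠ j → QuadraticMap.polar Q (b i) (b j) = 0) ∧
      ∀ i, Q (b i) ≠ 0 := by
  subst hN
  obtain ⟨b, hb⟩ := LinearMap.BilinForm.exists_orthogonal_basis (B := QuadraticMap.polarBilin Q)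
    ⟨fun x y => QuadraticMap.polar_comm Q x y⟩
  have hb' := LinearMap.isOrthoᵢ_def.1 hb
  refine ⟨b, hb', fun i h0 => ?_⟩
  -- An isotropic member of an orthogonal basis would be orthogonal to the whole space.
  refine hb.not_isOrtho_basis_self_of_separatingLeft hQ.1 i ?_
  rw [QuadraticMap.polarBilin_apply_apply, QuadraticMap.polar_self, h0,
    smul_zero]

theorem pairwise_ofFn_polar {R M : Type*} [CommRing R] [AddCommGroup M] [Module R M]
    {q : QuadraticForm R M} {N : ℕ} {b : Fin N → M}
    (hb : ∀ i j, i ≠ j → QuadraticMap.polar q (b i) (b j) = 0) :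
    (List.ofFn b).Pairwise fun v w => QuadraticMap.polar q v w = 0 :=
  List.pairwise_ofFn.2 fun i j hij => hb i j hij.ne

theorem span_mem_ofFn_basis {R M : Type*} [CommRing R] [AddCommGroup M] [Module R M]
    {N : ℕ} (b : Module.Basis (Fin N) R M) : Submodule.span R {v | v ∈ List.ofFn b} = ⊤ := by
  rw [← b.span_eq]
  congr 1
  ext v
  simp [List.mem_ofFn]

theorem finrank_cliffordAlgebra [Module.Finite F V]
    (hQ : (QuadraticMap.polarBilin Q).Nondegenerate) :
    Module.Finite F (CliffordAlgebra Q) ∧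
      Module.finrank F (CliffordAlgebra Q) = 2 ^ Module.finrank F V := by
  obtain ⟨b, hb, hb0⟩ := exists_orthogonal_basis_polar hQ rfl
  have h1 := finrank_productSpan (pairwise_ofFn_polar hb) (List.forall_mem_ofFn_iff.2 hb0)
  rw [productSpan_eq_top (pairwise_ofFn_polar hb) (span_mem_ofFn_basis b), List.length_ofFn,
    finrank_top] at h1
  exact ⟨Module.finite_def.2 (Module.Finite.iff_fg.1 h1.1), h1.2⟩

/-- This will be applied to the kernel of Φ. -/
theorem eq_bot_of_contractLeft_mem [Module.Finite F V]
    (hQ : (QuadraticMap.polarBilin Q).Nondegenerate) {K : Submodule F (CliffordAlgebra Q)}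
    (hK : ∀ v, ∀ x ∈ K, contractLeft (QuadraticMap.polarBilin Q v) x ∈ K) (h1 : 1 ∉ K) :
    K = ⊥ := by
  obtain ⟨b, hb, hb0⟩ := exists_orthogonal_basis_polar hQ rfl
  refine (Submodule.eq_bot_iff _).2 fun x hx => ?_
  refine inf_productSpan_eq_bot hK h1 (pairwise_ofFn_polar hb) (List.forall_mem_ofFn_iff.2 hb0)
    x hx ?_
  rw [productSpan_eq_top (pairwise_ofFn_polar hb) (span_mem_ofFn_basis b)]
  exact Submodule.mem_top

end Field

/-! ### Determinants of isometries, seen in the Clifford algebra -/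

section Determinant

open CliffordAlgebra

variable {R : Type*} [CommRing R] [Invertible (2 : R)] {M : Type*} [AddCommGroup M] [Module R M]
variable {q : QuadraticForm R M}

/-- `equivExterior` is only linear: at each new vector it adds a contraction by the associated
bilinear form, and orthogonality makes that correction vanish. -/
theorem equivExterior_prod_ι {l : List M}
    (hl : l.Pairwise fun v w => QuadraticMap.polar q v w = 0) :
    equivExterior q (l.map (ι q)).prod = (l.map (ExteriorAlgebra.ι R)).prod := by
  induction l with
  | nil => exact changeForm_one (Q := q) changeForm.associated_neg_proof
  | cons v l ih =>
    obtain ⟨hv, hl⟩ := List.pairwise_cons.1 hl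
    rw [List.map_cons, List.prod_cons, List.map_cons, List.prod_cons, ← ih hl]
    refine (changeForm_ι_mul (Q := q) changeForm.associated_neg_proof v _).trans ?_
    have h0 : contractLeft ((QuadraticMap.associated (R := R) (-q)) v)
        (equivExterior q (l.map (ι q)).prod) = 0 := by
      rw [ih hl]
      refine contractLeft_prod_ι_eq_zero fun w hw => ?_
      have h2 := hv w hw
      rw [map_neg, LinearMap.neg_apply, LinearMap.neg_apply, QuadraticMap.associated_apply]
      simp only [QuadraticMap.polar] at h2
      rw [h2]; simp
    exact sub_eq_self.2 h0

/-- An isometry multiplies the product of an orthogonal basis by its determinant. -/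
theorem prod_ι_map_basis {N : ℕ} (b : Module.Basis (Fin N) R M)
    (hb : ∀ i j, i ≠ j → QuadraticMap.polar q (b i) (b j) = 0) (f : Module.End R M)
    (hf : ∀ x, q (f x) = q x) :
    ((List.ofFn fun i => f (b i)).map (ι q)).prod =
      LinearMap.det f • ((List.ofFn b).map (ι q)).prod := by
  refine (equivExterior q).injective ?_
  have hp : ∀ x y, QuadraticMap.polar q (f x) (f y) = QuadraticMap.polar q x y := fun x y => by
    simp only [QuadraticMap.polar, ← map_add, hf]
  rw [map_smul, equivExterior_prod_ι (pairwise_ofFn_polar hb),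
    equivExterior_prod_ι (pairwise_ofFn_polar fun i j hij => (hp _ _).trans (hb i j hij))]
  have hι : ∀ v : Fin N → M, ((List.ofFn v).map (ExteriorAlgebra.ι R)).prod =
      ExteriorAlgebra.ιMulti R N v := fun v => by
    rw [ExteriorAlgebra.ιMulti_apply, List.map_ofFn]; rfl
  rw [hι, hι]
  -- Both products are of orthogonal families, so the claim becomes the action of f on the top
  -- exterior power.
  have key : (ExteriorAlgebra.ιMulti R N).compLinearMap f =
      LinearMap.det f • ExteriorAlgebra.ιMulti R N := by
    refine Module.Basis.ext_alternating b fun σ hσ => ?_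
    let e : Equiv.Perm (Fin N) := Equiv.ofBijective σ (Finite.injective_iff_bijective.1 hσ)
    -- On a free module of rank N, an alternating map in N variables is its value at the basis times
    -- the determinant form.
    have h1 : ((ExteriorAlgebra.ιMulti R N : M [⋀^Fin N]→ₗ[R] ExteriorAlgebra R M)) =
        (LinearMap.toSpanSingleton R _ (ExteriorAlgebra.ιMulti R N b)).compAlternatingMap b.det := by
      refine Module.Basis.ext_alternating b fun τ hτ => ?_
      let e : Equiv.Perm (Fin N) := Equiv.ofBijective τ (Finite.injective_iff_bijective.1 hτ)
      change ExteriorAlgebra.ιMulti R N (b ∘ e) = b.det (b ∘ e) • _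
      rw [AlternatingMap.map_perm, AlternatingMap.map_perm, b.det_self]
      simp
    rw [h1]
    change b.det (f ∘ fun i => b (σ i)) • ExteriorAlgebra.ιMulti R N b =
      LinearMap.det f • (b.det (fun i => b (σ i)) • ExteriorAlgebra.ιMulti R N b)
    rw [Module.Basis.det_comp, smul_smul]
  exact DFunLike.congr_fun key (b : Fin N → M)

end Determinant

/-! ### Even elements after scalar extension -/

section Even

open CliffordAlgebra

variable {F : Type u} [Field F] {V : Type v} [AddCommGroup V] [Module F V]

/-- The grade involution of `Cl(V, q)_R`. -/
def involuteExt (q : QuadraticForm F V) (R : Type w) [CommRing R] [Algebra F R] :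
    R ⊗[F] CliffordAlgebra q →ₐ[R] R ⊗[F] CliffordAlgebra q :=
  Algebra.TensorProduct.map (AlgHom.id R R) involute

variable (q : QuadraticForm F V) {R : Type w} [CommRing R] [Algebra F R]

@[simp] theorem involuteExt_tmul (r : R) (a : CliffordAlgebra q) :
    involuteExt q R (r ⊗ₜ a) = r ⊗ₜ involute a := rfl

@[simp] theorem tauExt_tmul (r : R) (a : CliffordAlgebra q) :
    tauExt q R (r ⊗ₜ a) = r ⊗ₜ reverse a := rfl

@[simp] theorem iotaExt_tmul (r : R) (v : V) : iotaExt q R (r ⊗ₜ v) = r ⊗ₜ ι q v := rfl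

theorem tauExt_iotaExt (x : R ⊗[F] V) : tauExt q R (iotaExt q R x) = iotaExt q R x := by
  induction x using TensorProduct.induction_on with
  | zero => simp
  | add x y hx hy => simp only [map_add, hx, hy]
  | tmul r v => simp

variable {q}

theorem tmul_mem_evenExt (r : R) {a : CliffordAlgebra q} (ha : a ∈ even q) :
    r ⊗ₜ[F] a ∈ evenExt q R :=
  Submodule.tmul_mem_baseChange_of_mem (p := Subalgebra.toSubmodule (even q)) r ha

theorem induction_evenExt {P : R ⊗[F] CliffordAlgebra q → Prop} (zero : P 0)
    (add : ∀ x y, P x → P y → P (x + y)) (tmul : ∀ (r : R), ∀ a ∈ even q, P (r ⊗ₜ a))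
    (x : R ⊗[F] CliffordAlgebra q) (hx : x ∈ evenExt q R) : P x := by
  have hx' : x ∈ (even q).toSubmodule.baseChange R := hx
  rw [Submodule.baseChange_eq_span] at hx'
  clear hx
  -- `P` is not assumed closed under scalars, so the span induction has to carry all multiples of x.
  suffices h : ∀ r : R, P (r • x) by simpa using h 1
  induction hx' using Submodule.span_induction with
  | zero => simpa using zero
  | add x y _ _ h h' => intro r; rw [smul_add]; exact add _ _ (h r) (h' r)
  | smul s x _ h => intro r; rw [smul_smul]; exact h _
  | mem x h =>
    obtain ⟨a, ha, rfl⟩ := h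
    intro r
    change P (r • (1 ⊗ₜ[F] a))
    rw [TensorProduct.smul_tmul', smul_eq_mul, mul_one]
    exact tmul r a ha

theorem involuteExt_of_mem_evenExt {x : R ⊗[F] CliffordAlgebra q} (hx : x ∈ evenExt q R) :
    involuteExt q R x = x := by
  refine induction_evenExt (P := fun x => involuteExt q R x = x) ?_ (fun x y hx hy => ?_) (fun r a ha => ?_) x hx
  · rw [map_zero]
  · rw [map_add, hx, hy]
  · rw [involuteExt_tmul, involute_eq_of_mem_even ha]

theorem tauExt_mul_self {u : (R ⊗[F] CliffordAlgebra q)ˣ} (hu : u ∈ spin q R) :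
    tauExt q R u * u = 1 := by
  rw [← Units.inv_eq_of_mul_eq_one_right hu.2.1, Units.inv_mul]

variable [Invertible (2 : F)]

/-- As 2 is invertible, half of x plus its involute is the projection to the even part. Evenness
thus becomes an equation, which can be tested after applying an injective map such as Φ_R or Ψ_R. -/
theorem mem_evenExt_iff {x : R ⊗[F] CliffordAlgebra q} :
    x ∈ evenExt q R ↔ involuteExt q R x = x := by
  refine ⟨involuteExt_of_mem_evenExt, fun h => ?_⟩
  have key : ∀ y : R ⊗[F] CliffordAlgebra q, y + involuteExt q R y ∈ evenExt q R := by
    intro y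
    induction y using TensorProduct.induction_on with
    | zero => simp
    | add x y hx hy =>
      rw [map_add, add_add_add_comm]
      exact add_mem hx hy
    | tmul r a =>
      rw [involuteExt_tmul, ← tmul_add]
      refine tmul_mem_evenExt r ?_
      obtain ⟨a0, h0, a1, h1, rfl⟩ := Submodule.mem_sup.1
        ((evenOdd_isCompl q).sup_eq_top ▸ Submodule.mem_top : a ∈ evenOdd q 0 ⊔ evenOdd q 1)
      rw [map_add, involute_eq_of_mem_even h0, involute_eq_of_mem_odd h1]
      have e : a0 + a1 + (a0 + -a1) = a0 + a0 := by abel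
      rw [e]
      exact (even q).add_mem h0 h0
  have h2 := (evenExt q R).smul_mem (key x) (algebraMap F R (⅟2))
  rwa [h, ← two_smul R x, smul_smul, ← map_ofNat (algebraMap F R) 2, ← map_mul, invOf_mul_self,
    map_one, one_smul] at h2

end Even

/-! ### The polar form over R -/

section Polar

variable {F : Type u} [Field F] {V : Type v} [AddCommGroup V] [Module F V]

/-- The extension to `V_R` of the polar form of `q`. -/
def polarExt (q : QuadraticForm F V) (R : Type w) [CommRing R] [Algebra F R] :
    LinearMap.BilinForm R (R ⊗[F] V) :=
  LinearMap.BilinForm.baseChange R (QuadraticMap.polarBilin q)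

variable {q : QuadraticForm F V} {R : Type w} [CommRing R] [Algebra F R]

@[simp] theorem polarExt_tmul (r s : R) (v w : V) :
    polarExt q R (r ⊗ₜ v) (s ⊗ₜ w) = r * s * algebraMap F R (QuadraticMap.polar q v w) := by
  rw [polarExt, LinearMap.BilinForm.baseChange_tmul, Algebra.smul_def,
    QuadraticMap.polarBilin_apply_apply, mul_comm]

theorem polarExt_comm (x y : R ⊗[F] V) : polarExt q R x y = polarExt q R y x := by
  induction x using TensorProduct.induction_on with
  | zero => simp
  | add x x' hx hx' => simp only [map_add, LinearMap.add_apply, hx, hx']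
  | tmul r v =>
    induction y using TensorProduct.induction_on with
    | zero => simp
    | add x x' hx hx' => simp only [map_add, LinearMap.add_apply, hx, hx']
    | tmul s w => simp [QuadraticMap.polar_comm q v w, mul_comm r s]

variable [Invertible (2 : F)]

theorem polarBilin_baseChange_eq (q : QuadraticForm F V) (R : Type w) [CommRing R] [Algebra F R] :
    QuadraticMap.polarBilin (q.baseChange R) = polarExt q R := by
  let _ : Invertible (2 : R) :=
    (Invertible.map (algebraMap F R) (2 : F)).copy 2 (map_ofNat _ 2).symm
  exact QuadraticForm.polarBilin_baseChange q

/-- With 2 invertible the form is half its polar form on the diagonal. The bilinear version is the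
useful one, because bilinear identities can be checked on pure tensors. -/
theorem isometry_iff_polarExt {f : Module.End R (R ⊗[F] V)} :
    (∀ x, q.baseChange R (f x) = q.baseChange R x) ↔
      ∀ x y, polarExt q R (f x) (f y) = polarExt q R x y := by
  let _ : Invertible (2 : R) :=
    (Invertible.map (algebraMap F R) (2 : F)).copy 2 (map_ofNat _ 2).symm
  rw [← polarBilin_baseChange_eq]
  refine ⟨fun h x y => ?_, fun h x => ?_⟩
  · simp only [QuadraticMap.polarBilin_apply_apply, QuadraticMap.polar, ← map_add, h]
  · have h3 := h x x
    rw [QuadraticMap.polarBilin_apply_apply, QuadraticMap.polarBilin_apply_apply,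
      QuadraticMap.polar_self, QuadraticMap.polar_self] at h3
    exact (isUnit_of_invertible (2 : R)).mul_left_cancel (by simpa [two_smul, two_mul] using h3)

theorem eq_of_polarExt [Module.Finite F V] (hq : (QuadraticMap.polarBilin q).Nondegenerate)
    {x y : R ⊗[F] V} (h : ∀ z, polarExt q R x z = polarExt q R y z) : x = y := by
  obtain ⟨b, hb, hb0⟩ := exists_orthogonal_basis_polar hq rfl
  -- Pairing with a vector of an orthogonal basis reads off the coordinate, up to 2 q(b i), which is
  -- nonzero in F and hence a unit in R.
  have key : ∀ (z : R ⊗[F] V) i, polarExt q R z (1 ⊗ₜ b i) =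
      (Algebra.TensorProduct.basis R b).repr z i * algebraMap F R (2 * q (b i)) := by
    intro z i
    induction z using TensorProduct.induction_on with
    | zero => simp
    | add x x' hx hx' => simp only [map_add, LinearMap.add_apply, hx, hx', Finsupp.add_apply, add_mul]
    | tmul r v =>
      rw [polarExt_tmul, Algebra.TensorProduct.basis_repr_tmul]
      simp only [Finsupp.smul_apply, Finsupp.mapRange_apply, smul_eq_mul, mul_one, mul_assoc]
      congr 1
      have h1 : QuadraticMap.polar q v (b i) = b.repr v i * (2 * q (b i)) := by
        conv_lhs => rw [← b.sum_repr v]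
        rw [← QuadraticMap.polarBilin_apply_apply, map_sum, LinearMap.sum_apply,
          Finset.sum_eq_single i]
        · simp [QuadraticMap.polar_self]
        · intro j _ hj
          simp [hb j i hj]
        · simp
      rw [h1, map_mul]
  refine (Algebra.TensorProduct.basis R b).repr.injective (Finsupp.ext fun i => ?_)
  have h1 := h (1 ⊗ₜ b i)
  rw [key, key] at h1
  exact ((mul_ne_zero (Invertible.ne_zero 2) (hb0 i)).isUnit.map
    (algebraMap F R)).mul_right_cancel h1

end Polar

/-! ### Endomorphism algebras under base change -/

section BaseChange

theorem tensorProductEnd_tmul {F : Type*} [Field F] {R : Type*} [CommRing R] [Algebra F R]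
    {V : Type*} [AddCommGroup V] [Module F V] (r : R) (f : Module.End F V) :
    LinearMap.tensorProductEnd F R V (r ⊗ₜ f) = r • f.baseChange R :=
  rfl

/-- A finite-dimensional V is finitely presented, so forming Hom(V, V) commutes with base change. -/
theorem tensorProductEnd_bijective (F : Type*) [Field F] (R : Type*) [CommRing R] [Algebra F R]
    (V : Type*) [AddCommGroup V] [Module F V] [Module.Finite F V] :
    Function.Bijective (LinearMap.tensorProductEnd F R V) := by
  have hfp := Module.finitePresentation_of_finite F V
  have h := Module.FinitePresentation.isBaseChange_map F V V R
  have e : ⇑(LinearMap.tensorProductEnd F R V) = ⇑h.equiv := by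
    funext x
    induction x using TensorProduct.induction_on with
    | zero => simp
    | add x y hx hy => rw [map_add, map_add, hx, hy]
    | tmul r f => rw [tensorProductEnd_tmul, h.equiv_tmul]; rfl
  rw [e]
  exact h.equiv.bijective

end BaseChange

/-! ### The representation Φ is an isomorphism -/

section Representation

open CliffordAlgebra

variable {F : Type u} [Field F]
variable {C : Type v} [NonAssocRing C] [Module F C] [SMulCommClass F C C] [IsScalarTower F C C]
variable {n : QuadraticForm F C} (h : IsCayley n)

/-- The grading operator `(a, b) ↦ (a, -b)`. -/
def gradeOp (F : Type u) [Field F] (C : Type v) [AddCommGroup C] [Module F C] :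
    Module.End F (C × C) :=
  LinearMap.prodMap LinearMap.id (-LinearMap.id)

@[simp] theorem cliffordRep_ι (x : C) (p : C × C) :
    cliffordRep h (ι n x) p = (bar n x * bar n p.2, bar n p.1 * bar n x) := by
  rw [cliffordRep, lift_ι_apply]
  rfl

/-- Vectors act by off-diagonal blocks, so the grading operator anticommutes with them. It is
through this identity that even elements are recognized by block-diagonal action. -/
theorem gradeOp_cliffordRep (x : CliffordAlgebra n) (p : C × C) :
    gradeOp F C (cliffordRep h x p) = cliffordRep h (involute x) (gradeOp F C p) := by
  induction x using CliffordAlgebra.left_induction with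
  | algebraMap r => simp
  | add x y hx hy => simp only [map_add, LinearMap.add_apply, hx, hy]
  | ι_mul x m hx =>
    rw [map_mul, map_mul, map_mul, Module.End.mul_apply, Module.End.mul_apply, ← hx, involute_ι,
      map_neg, LinearMap.neg_apply, cliffordRep_ι, cliffordRep_ι]
    simp [gradeOp]

theorem cliffordRep_bijective [Invertible (2 : F)] : Function.Bijective (cliffordRep h) := by
  have hfin := h.finite
  obtain ⟨h1, h2⟩ := finrank_cliffordAlgebra h.nondegenerate
  have hinj : Function.Injective (cliffordRep h).toLinearMap := by
    rw [← LinearMap.ker_eq_bot]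
    have hnt : Nontrivial C := Module.nontrivial_of_finrank_pos (R := F)
      (by rw [h.finrank_eq]; norm_num)
    refine eq_bot_of_contractLeft_mem h.nondegenerate (fun v x hx => ?_) ?_
    · rw [LinearMap.mem_ker, AlgHom.toLinearMap_apply] at hx ⊢
      -- The kernel is graded: the involution acts through conjugation by the grading operator.
      have hinv : cliffordRep h (involute x) = 0 := by
        refine LinearMap.ext fun p => ?_
        have e : p = gradeOp F C (gradeOp F C p) := by simp [gradeOp]
        rw [e, ← gradeOp_cliffordRep, hx]
        simp
      -- Contraction is a supercommutator, so it preserves a graded two-sided ideal.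
      rw [← ι_mul_sub_involute_mul_ι, map_sub, map_mul, map_mul, hx, hinv]
      simp
    · rw [LinearMap.mem_ker, AlgHom.toLinearMap_apply, map_one]
      exact one_ne_zero
  refine ⟨hinj, ?_⟩
  refine (LinearMap.injective_iff_surjective_of_finrank_eq_finrank
    (f := (cliffordRep h).toLinearMap) ?_).1 hinj
  -- 2^8 = (8 + 8)^2.
  rw [h2, Module.finrank_linearMap, Module.finrank_prod, h.finrank_eq]
  norm_num

/-- The operators l_x and r_x are adjoint for n, so a vector acts by a self-adjoint operator for n ⊥
n. As τ fixes vectors and reverses products, Φ carries it to the adjoint. -/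
theorem polar_cliffordRep (x : CliffordAlgebra n) (p q : C × C) :
    QuadraticMap.polar n (cliffordRep h x p).1 q.1 +
        QuadraticMap.polar n (cliffordRep h x p).2 q.2 =
      QuadraticMap.polar n p.1 (cliffordRep h (reverse x) q).1 +
        QuadraticMap.polar n p.2 (cliffordRep h (reverse x) q).2 := by
  induction x using CliffordAlgebra.left_induction generalizing q with
  | algebraMap r =>
    simp
  | add x y hx hy =>
    simp only [map_add, LinearMap.add_apply, Prod.fst_add, Prod.snd_add,
      QuadraticMap.polar_add_left, QuadraticMap.polar_add_right]
    linear_combination hx q + hy q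
  | ι_mul x m hx =>
    rw [reverse.map_mul, map_mul, map_mul, reverse_ι, Module.End.mul_apply, Module.End.mul_apply,
      ← hx]
    generalize cliffordRep h x p = p
    simp only [cliffordRep_ι]
    rw [h.polar_adj_left, h.polar_adj_right (bar n p.1), h.bar_bar, h.polar_bar p.1, h.polar_bar p.2,
      h.bar_mul, h.bar_mul, add_comm]

variable (R : Type w) [CommRing R] [Algebra F R]

/-- The scalar extension `Φ_R` of the representation of the Clifford algebra. -/
def cliffordRepExt :
    R ⊗[F] CliffordAlgebra n →ₐ[R] Module.End R (R ⊗[F] (C × C)) :=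
  (LinearMap.tensorProductEnd F R (C × C)).comp
    (Algebra.TensorProduct.map (AlgHom.id R R) (cliffordRep h))

variable {R}

@[simp] theorem cliffordRepExt_tmul (r s : R) (x : CliffordAlgebra n) (p : C × C) :
    cliffordRepExt h R (r ⊗ₜ x) (s ⊗ₜ p) = (r * s) ⊗ₜ cliffordRep h x p := by
  simp [cliffordRepExt, tensorProductEnd_tmul, TensorProduct.smul_tmul',
    -LinearMap.tensorProductEnd_apply]

theorem cliffordRepExt_bijective [Invertible (2 : F)] :
    Function.Bijective (cliffordRepExt h R) := by
  have hfin := h.finite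
  have e : ⇑(Algebra.TensorProduct.map (AlgHom.id R R) (cliffordRep h)) =
      ⇑(Algebra.TensorProduct.congr (AlgEquiv.refl (R := R) (A₁ := R))
        (AlgEquiv.ofBijective (cliffordRep h) (cliffordRep_bijective h))) := rfl
  rw [cliffordRepExt, AlgHom.coe_comp, e]
  exact (tensorProductEnd_bijective F R (C × C)).comp (AlgEquiv.bijective _)

end Representation

/-! ### Block decomposition of Φ_R -/

section Blocks

open CliffordAlgebra

variable {F : Type u} [Field F]
variable {C : Type v} [NonAssocRing C] [Module F C]
variable {R : Type w} [CommRing R] [Algebra F R]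

/-- The inclusion of the first summand in `(C ⊕ C)_R`. -/
def inlExt (F : Type u) [Field F] (C : Type v) [NonAssocRing C] [Module F C] (R : Type w)
    [CommRing R] [Algebra F R] : R ⊗[F] C →ₗ[R] R ⊗[F] (C × C) :=
  (LinearMap.inl F C C).baseChange R

/-- The inclusion of the second summand in `(C ⊕ C)_R`. -/
def inrExt (F : Type u) [Field F] (C : Type v) [NonAssocRing C] [Module F C] (R : Type w)
    [CommRing R] [Algebra F R] : R ⊗[F] C →ₗ[R] R ⊗[F] (C × C) :=
  (LinearMap.inr F C C).baseChange R

/-- The projection of `(C ⊕ C)_R` to the first summand. -/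
def fstExt (F : Type u) [Field F] (C : Type v) [NonAssocRing C] [Module F C] (R : Type w)
    [CommRing R] [Algebra F R] : R ⊗[F] (C × C) →ₗ[R] R ⊗[F] C :=
  (LinearMap.fst F C C).baseChange R

/-- The projection of `(C ⊕ C)_R` to the second summand. -/
def sndExt (F : Type u) [Field F] (C : Type v) [NonAssocRing C] [Module F C] (R : Type w)
    [CommRing R] [Algebra F R] : R ⊗[F] (C × C) →ₗ[R] R ⊗[F] C :=
  (LinearMap.snd F C C).baseChange R

@[simp] theorem inlExt_tmul (r : R) (c : C) : inlExt F C R (r ⊗ₜ c) = r ⊗ₜ (c, 0) := rfl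
@[simp] theorem inrExt_tmul (r : R) (c : C) : inrExt F C R (r ⊗ₜ c) = r ⊗ₜ (0, c) := rfl
@[simp] theorem fstExt_tmul (r : R) (p : C × C) : fstExt F C R (r ⊗ₜ p) = r ⊗ₜ p.1 := rfl
@[simp] theorem sndExt_tmul (r : R) (p : C × C) : sndExt F C R (r ⊗ₜ p) = r ⊗ₜ p.2 := rfl

@[simp] theorem fstExt_inlExt (x : R ⊗[F] C) : fstExt F C R (inlExt F C R x) = x := by
  induction x using TensorProduct.induction_on with
  | zero => simp
  | add x y hx hy => simp only [map_add, hx, hy]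
  | tmul r c => simp

@[simp] theorem sndExt_inlExt (x : R ⊗[F] C) : sndExt F C R (inlExt F C R x) = 0 := by
  induction x using TensorProduct.induction_on with
  | zero => simp
  | add x y hx hy => simp only [map_add, hx, hy, add_zero]
  | tmul r c => simp

@[simp] theorem fstExt_inrExt (x : R ⊗[F] C) : fstExt F C R (inrExt F C R x) = 0 := by
  induction x using TensorProduct.induction_on with
  | zero => simp
  | add x y hx hy => simp only [map_add, hx, hy, add_zero]
  | tmul r c => simp

@[simp] theorem sndExt_inrExt (x : R ⊗[F] C) : sndExt F C R (inrExt F C R x) = x := by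
  induction x using TensorProduct.induction_on with
  | zero => simp
  | add x y hx hy => simp only [map_add, hx, hy]
  | tmul r c => simp

theorem inlExt_fstExt_add (p : R ⊗[F] (C × C)) :
    inlExt F C R (fstExt F C R p) + inrExt F C R (sndExt F C R p) = p := by
  induction p using TensorProduct.induction_on with
  | zero => simp
  | add x y hx hy =>
    simp only [map_add]
    rw [add_add_add_comm, hx, hy]
  | tmul r c => simp [← tmul_add]

theorem prodExt_ext {p q : R ⊗[F] (C × C)} (h1 : fstExt F C R p = fstExt F C R q)
    (h2 : sndExt F C R p = sndExt F C R q) : p = q := by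
  rw [← inlExt_fstExt_add p, h1, h2, inlExt_fstExt_add]

theorem gradeOp_baseChange (p : R ⊗[F] (C × C)) : (gradeOp F C).baseChange R p =
    inlExt F C R (fstExt F C R p) - inrExt F C R (sndExt F C R p) := by
  induction p using TensorProduct.induction_on with
  | zero => simp
  | add x y hx hy =>
    simp only [map_add, hx, hy]
    abel
  | tmul r c => simp [← tmul_sub, gradeOp]

theorem endExt_ext {T T' : Module.End R (R ⊗[F] (C × C))}
    (h1 : ∀ x, T (inlExt F C R x) = T' (inlExt F C R x))
    (h2 : ∀ x, T (inrExt F C R x) = T' (inrExt F C R x)) : T = T' :=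
  LinearMap.ext fun p => by rw [← inlExt_fstExt_add p, map_add, map_add, h1, h2]

theorem GL_surjective (f : LinearMap.GeneralLinearGroup R (R ⊗[F] C)) :
    Function.Surjective (f : Module.End R (R ⊗[F] C)) := fun x =>
  ⟨((f⁻¹ : LinearMap.GeneralLinearGroup R (R ⊗[F] C)) : Module.End R (R ⊗[F] C)) x, by
    rw [← Module.End.mul_apply, Units.mul_inv, Module.End.one_apply]⟩

variable [SMulCommClass F C C] [IsScalarTower F C C] {n : QuadraticForm F C} (h : IsCayley n)

theorem gradeOp_cliffordRepExt (u : R ⊗[F] CliffordAlgebra n) (p : R ⊗[F] (C × C)) :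
    (gradeOp F C).baseChange R (cliffordRepExt h R u p) =
      cliffordRepExt h R (involuteExt n R u) ((gradeOp F C).baseChange R p) := by
  induction u using TensorProduct.induction_on with
  | zero => simp
  | add x y hx hy => simp only [map_add, LinearMap.add_apply, hx, hy]
  | tmul r x =>
    induction p using TensorProduct.induction_on with
    | zero => simp
    | add x y hx hy => simp only [map_add, hx, hy]
    | tmul s c => simp [gradeOp_cliffordRep]

theorem rhoMinus_apply (u : R ⊗[F] CliffordAlgebra n) (x : R ⊗[F] C) :
    rhoMinus h R u x = fstExt F C R (cliffordRepExt h R u (inlExt F C R x)) := by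
  induction u using TensorProduct.induction_on with
  | zero => simp
  | add x y hx hy => simp only [map_add, LinearMap.add_apply, hx, hy]
  | tmul r a =>
    induction x using TensorProduct.induction_on with
    | zero => simp
    | add x y hx hy => simp only [map_add, hx, hy]
    | tmul s c => simp [rhoMinus, blockMinus, tensorProductEnd_tmul,
        TensorProduct.smul_tmul', -LinearMap.tensorProductEnd_apply]

theorem rhoPlus_apply (u : R ⊗[F] CliffordAlgebra n) (x : R ⊗[F] C) :
    rhoPlus h R u x = sndExt F C R (cliffordRepExt h R u (inrExt F C R x)) := by
  induction u using TensorProduct.induction_on with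
  | zero => simp
  | add x y hx hy => simp only [map_add, LinearMap.add_apply, hx, hy]
  | tmul r a =>
    induction x using TensorProduct.induction_on with
    | zero => simp
    | add x y hx hy => simp only [map_add, hx, hy]
    | tmul s c => simp [rhoPlus, blockPlus, tensorProductEnd_tmul,
        TensorProduct.smul_tmul', -LinearMap.tensorProductEnd_apply]

theorem rhoPlus_one : rhoPlus h R 1 = 1 :=
  LinearMap.ext fun x => by
    rw [rhoPlus_apply, map_one, Module.End.one_apply, sndExt_inrExt, Module.End.one_apply]

theorem rhoMinus_one : rhoMinus h R 1 = 1 :=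
  LinearMap.ext fun x => by
    rw [rhoMinus_apply, map_one, Module.End.one_apply, fstExt_inlExt, Module.End.one_apply]

theorem cliffordRepExt_iotaExt_inlExt (x y : R ⊗[F] C) :
    cliffordRepExt h R (iotaExt n R x) (inlExt F C R y) = inrExt F C R (para n R y x) := by
  unfold para
  induction x using TensorProduct.induction_on with
  | zero => simp
  | add x x' hx hx' => simp only [map_add, mul_add, LinearMap.add_apply, hx, hx']
  | tmul r c =>
    induction y using TensorProduct.induction_on with
    | zero => simp
    | add x x' hx hx' => simp only [map_add, add_mul, hx, hx']
    | tmul s d => simp [mul_comm r s]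

theorem cliffordRepExt_iotaExt_inrExt (x y : R ⊗[F] C) :
    cliffordRepExt h R (iotaExt n R x) (inrExt F C R y) = inlExt F C R (para n R x y) := by
  unfold para
  induction x using TensorProduct.induction_on with
  | zero => simp
  | add x x' hx hx' => simp only [map_add, add_mul, LinearMap.add_apply, hx, hx']
  | tmul r c =>
    induction y using TensorProduct.induction_on with
    | zero => simp
    | add x x' hx hx' => simp only [map_add, mul_add, hx, hx']
    | tmul s d => simp

theorem polarExt_cliffordRepExt (u : R ⊗[F] CliffordAlgebra n) (p q : R ⊗[F] (C × C)) :
    polarExt n R (fstExt F C R (cliffordRepExt h R u p)) (fstExt F C R q) +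
        polarExt n R (sndExt F C R (cliffordRepExt h R u p)) (sndExt F C R q) =
      polarExt n R (fstExt F C R p) (fstExt F C R (cliffordRepExt h R (tauExt n R u) q)) +
        polarExt n R (sndExt F C R p) (sndExt F C R (cliffordRepExt h R (tauExt n R u) q)) := by
  induction u using TensorProduct.induction_on with
  | zero => simp
  | add x y hx hy =>
    simp only [map_add, LinearMap.add_apply]
    linear_combination hx + hy
  | tmul r x =>
    induction p using TensorProduct.induction_on with
    | zero => simp
    | add x y hx hy =>
      simp only [map_add, LinearMap.add_apply]
      linear_combination hx + hy
    | tmul s c =>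
      induction q using TensorProduct.induction_on with
      | zero => simp
      | add x y hx hy =>
        simp only [map_add]
        linear_combination hx + hy
      | tmul t d =>
        have h1 := congrArg (algebraMap F R) (polar_cliffordRep h x c d)
        simp only [map_add] at h1
        simp only [cliffordRepExt_tmul, fstExt_tmul, sndExt_tmul, polarExt_tmul, tauExt_tmul]
        linear_combination r * s * t * h1

/-- The para-Cayley product is associative with respect to the norm. -/
theorem polarExt_para (h : IsCayley n) (x y z : R ⊗[F] C) :
    polarExt n R (para n R x y) z = polarExt n R x (para n R y z) := by
  -- This is self-adjointness of the action of the vector y, tested on x in the first summand and z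
  -- in the second.
  have h1 := polarExt_cliffordRepExt h (iotaExt n R y) (inlExt F C R x) (inrExt F C R z)
  rw [tauExt_iotaExt, cliffordRepExt_iotaExt_inlExt, cliffordRepExt_iotaExt_inrExt] at h1
  simpa using h1

section
variable [Invertible (2 : F)]

/-- An even element acts by an operator that commutes with the grading operator, so twice its
off-diagonal block vanishes, and 2 is a unit. -/
theorem cliffordRepExt_inlExt {u : R ⊗[F] CliffordAlgebra n} (hu : u ∈ evenExt n R)
    (x : R ⊗[F] C) :
    cliffordRepExt h R u (inlExt F C R x) = inlExt F C R (rhoMinus h R u x) := by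
  let _ : Invertible (2 : R) :=
    (Invertible.map (algebraMap F R) (2 : F)).copy 2 (map_ofNat _ 2).symm
  have h1 := gradeOp_cliffordRepExt h u (inlExt F C R x)
  rw [involuteExt_of_mem_evenExt hu, gradeOp_baseChange, gradeOp_baseChange] at h1
  have h2 := congrArg (sndExt F C R) h1
  simp only [map_sub, sndExt_inlExt, sndExt_inrExt, fstExt_inlExt, map_zero, sub_zero,
    zero_sub, neg_eq_iff_add_eq_zero, ← two_smul R] at h2
  refine prodExt_ext (by rw [rhoMinus_apply, fstExt_inlExt]) ?_
  rw [sndExt_inlExt]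
  exact (isUnit_of_invertible (2 : R)).smul_eq_zero.1 h2

theorem cliffordRepExt_inrExt {u : R ⊗[F] CliffordAlgebra n} (hu : u ∈ evenExt n R)
    (x : R ⊗[F] C) :
    cliffordRepExt h R u (inrExt F C R x) = inrExt F C R (rhoPlus h R u x) := by
  let _ : Invertible (2 : R) :=
    (Invertible.map (algebraMap F R) (2 : F)).copy 2 (map_ofNat _ 2).symm
  have h1 := gradeOp_cliffordRepExt h u (inrExt F C R x)
  rw [involuteExt_of_mem_evenExt hu, gradeOp_baseChange, gradeOp_baseChange] at h1
  have h2 := congrArg (fstExt F C R) h1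
  simp only [map_sub, fstExt_inrExt, sndExt_inrExt, fstExt_inlExt, map_zero, sub_zero,
    zero_sub, map_neg, eq_neg_iff_add_eq_zero, ← two_smul R] at h2
  refine prodExt_ext ?_ (by rw [rhoPlus_apply, sndExt_inrExt])
  rw [fstExt_inrExt]
  exact (isUnit_of_invertible (2 : R)).smul_eq_zero.1 h2

end

end Blocks

/-! ### The vector representation and its determinant -/

section Conjugation

open CliffordAlgebra

variable {F : Type u} [Field F] [Invertible (2 : F)] {V : Type v} [AddCommGroup V] [Module F V]
variable {q : QuadraticForm F V} {R : Type w} [CommRing R] [Algebra F R]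

theorem algebraMap_clifford_injective :
    Function.Injective (algebraMap R (R ⊗[F] CliffordAlgebra q)) :=
  Algebra.TensorProduct.includeLeft_injective (S := R)
    (algebraMap F (CliffordAlgebra q)).injective

theorem toBaseChange_ι_eq (x : R ⊗[F] V) :
    toBaseChange R q (ι (q.baseChange R) x) = iotaExt q R x := by
  induction x using TensorProduct.induction_on with
  | zero => simp
  | add x y hx hy => simp only [map_add, hx, hy]
  | tmul r v => simp

theorem iotaExt_mul_self (x : R ⊗[F] V) :
    iotaExt q R x * iotaExt q R x = algebraMap R _ (q.baseChange R x) := by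
  rw [← toBaseChange_ι_eq, ← map_mul, ι_sq_scalar, AlgHom.commutes]

theorem ι_injective (q : QuadraticForm F V) : Function.Injective (ι q) := by
  intro x y hxy
  have h1 := congrArg (equivExterior q) hxy
  have h2 : ∀ z, equivExterior q (ι q z) = ExteriorAlgebra.ι F z := fun z =>
    changeForm_ι (Q := q) changeForm.associated_neg_proof z
  rw [h2, h2] at h1
  exact ExteriorAlgebra.ι_leftInverse.injective h1

/-- A linear retraction of the inclusion of `V` in `Cl(V, q)`. -/
def vectorPart (q : QuadraticForm F V) : CliffordAlgebra q →ₗ[F] V :=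
  ((ι q).exists_leftInverse_of_injective (LinearMap.ker_eq_bot.2 (ι_injective q))).choose

theorem vectorPart_ι (x : V) : vectorPart q (ι q x) = x :=
  LinearMap.congr_fun ((ι q).exists_leftInverse_of_injective
    (LinearMap.ker_eq_bot.2 (ι_injective q))).choose_spec x

theorem vectorPart_iotaExt (x : R ⊗[F] V) :
    (vectorPart q).baseChange R (iotaExt q R x) = x := by
  induction x using TensorProduct.induction_on with
  | zero => simp
  | add x y hx hy => simp only [map_add, hx, hy]
  | tmul r v => simp [vectorPart_ι]

theorem iotaExt_injective : Function.Injective (iotaExt q R) :=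
  Function.LeftInverse.injective vectorPart_iotaExt

/-- The endomorphism `x ↦ u · x · u⁻¹` of `V_R`, for `u` in the Clifford group. -/
def chi (u : (R ⊗[F] CliffordAlgebra q)ˣ) : Module.End R (R ⊗[F] V) :=
  (vectorPart q).baseChange R ∘ₗ
    LinearMap.mulLeft R (u : R ⊗[F] CliffordAlgebra q) ∘ₗ
    LinearMap.mulRight R ((u⁻¹ : (R ⊗[F] CliffordAlgebra q)ˣ) : R ⊗[F] CliffordAlgebra q) ∘ₗ
    iotaExt q R

/-- `chi` is defined for every unit by means of an arbitrary retraction. For a spin element the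
conjugate is already a vector, so the choice does not matter. -/
theorem iotaExt_chi {u : (R ⊗[F] CliffordAlgebra q)ˣ} (hu : u ∈ spin q R) (x : R ⊗[F] V) :
    iotaExt q R (chi u x) = u * iotaExt q R x * ↑u⁻¹ := by
  obtain ⟨y, hy⟩ : (u : R ⊗[F] CliffordAlgebra q) * iotaExt q R x * ↑u⁻¹ ∈
      Set.range (iotaExt q R) := by
    rw [← hu.2.2]
    exact ⟨_, ⟨x, rfl⟩, rfl⟩
  have h1 : chi u x = (vectorPart q).baseChange R
      ((u : R ⊗[F] CliffordAlgebra q) * iotaExt q R x * ↑u⁻¹) := by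
    rw [mul_assoc]; rfl
  rw [h1, ← hy, vectorPart_iotaExt]

theorem chi_mul {u v : (R ⊗[F] CliffordAlgebra q)ˣ} (hu : u ∈ spin q R) (hv : v ∈ spin q R) :
    chi (u * v) = chi u * chi v := by
  refine LinearMap.ext fun x => iotaExt_injective (q := q) ?_
  rw [iotaExt_chi (mul_mem hu hv), Module.End.mul_apply, iotaExt_chi hu, iotaExt_chi hv,
    mul_inv_rev, Units.val_mul, Units.val_mul]
  simp only [mul_assoc]

theorem chi_one : chi (1 : (R ⊗[F] CliffordAlgebra q)ˣ) = 1 := by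
  refine LinearMap.ext fun x => iotaExt_injective (q := q) ?_
  rw [iotaExt_chi (one_mem _)]
  simp

/-- Conjugation fixes the central scalar x · x = q(x), and R embeds in the Clifford algebra. -/
theorem baseChange_chi {u : (R ⊗[F] CliffordAlgebra q)ˣ} (hu : u ∈ spin q R) (x : R ⊗[F] V) :
    q.baseChange R (chi u x) = q.baseChange R x := by
  refine algebraMap_clifford_injective (q := q) ?_
  rw [← iotaExt_mul_self, ← iotaExt_mul_self, iotaExt_chi hu]
  have e : ∀ a : R ⊗[F] CliffordAlgebra q,
      (u : R ⊗[F] CliffordAlgebra q) * a * ↑u⁻¹ * (u * a * ↑u⁻¹) = u * (a * a) * ↑u⁻¹ := by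
    intro a
    simp only [mul_assoc, Units.inv_mul_cancel_left]
  rw [e, iotaExt_mul_self, ← Algebra.commutes, mul_assoc, Units.mul_inv, mul_one]

/-- Let W be the product of an orthogonal basis. Conjugation by u multiplies W by det χ_u because
χ_u is an isometry, and fixes W because u is even and the dimension is even. As W is invertible and
R embeds in the Clifford algebra, the determinant is 1. -/
theorem det_chi [Module.Finite F V] (hq : (QuadraticMap.polarBilin q).Nondegenerate)
    (he : Even (Module.finrank F V)) {u : (R ⊗[F] CliffordAlgebra q)ˣ} (hu : u ∈ spin q R) :
    LinearMap.det (chi u) = 1 := by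
  let _ : Invertible (2 : R) :=
    (Invertible.map (algebraMap F R) (2 : F)).copy 2 (map_ofNat _ 2).symm
  obtain ⟨b, hb, hb0⟩ := exists_orthogonal_basis_polar hq rfl
  let bR := Algebra.TensorProduct.basis R b
  have hbR : ∀ i j, i ≠ j → QuadraticMap.polar (q.baseChange R) (bR i) (bR j) = 0 := by
    intro i j hij
    rw [← QuadraticMap.polarBilin_apply_apply, polarBilin_baseChange_eq]
    simp [bR, hb i j hij]
  set W : R ⊗[F] CliffordAlgebra q := ((List.ofFn bR).map (iotaExt q R)).prod with hW
  have hmap : ∀ l : List (R ⊗[F] V), toBaseChange R q (l.map (ι (q.baseChange R))).prod =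
      (l.map (iotaExt q R)).prod := by
    intro l
    rw [map_list_prod, List.map_map]
    congr 2
    funext x
    exact toBaseChange_ι_eq x
  have h1 := congrArg (toBaseChange R q) (prod_ι_map_basis bR hbR (chi u) (baseChange_chi hu))
  rw [map_smul, hmap, hmap] at h1
  have h2 : ((List.ofFn fun i => chi u (bR i)).map (iotaExt q R)).prod = u * W * ↑u⁻¹ := by
    have e : ∀ l : List (R ⊗[F] V), ((l.map (chi u)).map (iotaExt q R)).prod =
        u * (l.map (iotaExt q R)).prod * ↑u⁻¹ := by
      intro l
      induction l with
      | nil => simp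
      | cons x l ih =>
        simp only [List.map_cons, List.prod_cons, ih, iotaExt_chi hu, mul_assoc,
          Units.inv_mul_cancel_left]
    rw [hW, ← e, List.map_ofFn (f := bR)]
    rfl
  -- In Cl(V_R, q_R), W · x is the involute of x times W; the even element u is its own involute.
  have h3 : W * u = u * W := by
    have h4 := prod_mul_eq_involute_mul_prod (pairwise_ofFn_polar hbR) (span_mem_ofFn_basis bR)
      (by rwa [List.length_ofFn]) (ofBaseChange R q u)
    have h5 := congrArg (toBaseChange R q) h4
    rw [map_mul, map_mul, toBaseChange_involute, toBaseChange_ofBaseChange, hmap] at h5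
    rw [hW, h5]
    congr 1
    exact involuteExt_of_mem_evenExt hu.1
  rw [h2, ← h3, mul_assoc, Units.mul_inv, mul_one] at h1
  -- Each factor squares to the scalar q(b i), a unit.
  have hu1 : IsUnit W := by
    rw [hW]
    refine List.prod_isUnit fun a ha => ?_
    obtain ⟨x, hx, rfl⟩ := List.mem_map.1 ha
    obtain ⟨i, rfl⟩ := List.mem_ofFn.1 hx
    have hi : IsUnit (iotaExt q R (bR i) * iotaExt q R (bR i)) := by
      rw [iotaExt_mul_self]
      refine IsUnit.map _ ?_
      simpa [bR, Algebra.smul_def] using (hb0 i).isUnit.map (algebraMap F R)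
    exact ((Commute.refl _).isUnit_mul_iff.1 hi).1
  refine algebraMap_clifford_injective (q := q) (hu1.mul_right_cancel ?_)
  rw [map_one, one_mul, ← Algebra.smul_def]
  exact h1.symm

end Conjugation

/-! ### Spin elements and related triples -/

section Triality

open CliffordAlgebra

variable {F : Type u} [Field F] [Invertible (2 : F)]
variable {C : Type v} [NonAssocRing C] [Module F C] [SMulCommClass F C C] [IsScalarTower F C C]
variable {n : QuadraticForm F C} (h : IsCayley n) {R : Type w} [CommRing R] [Algebra F R]

/-- `(f₀, f₁, f₂)` is a related triple: `f₀(x • y) = f₁(x) • f₂(y)`. -/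
def Related (n : QuadraticForm F C) (f₀ f₁ f₂ : Module.End R (R ⊗[F] C)) : Prop :=
  ∀ x y, f₀ (para n R x y) = para n R (f₁ x) (f₂ y)

/-- Isometries of the extended polar form of `n`. -/
def IsometricEnd (n : QuadraticForm F C) (f : Module.End R (R ⊗[F] C)) : Prop :=
  ∀ x y, polarExt n R (f x) (f y) = polarExt n R x y

/-- Related triples of isometries can be permuted cyclically. -/
theorem Related.rotate (h : IsCayley n) {f₀ f₁ f₂ : Module.End R (R ⊗[F] C)}
    (hf : Related n f₀ f₁ f₂) (h0 : IsometricEnd n f₀) (h1 : IsometricEnd n f₁)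
    (hs : Function.Surjective f₁) : Related n f₁ f₂ f₀ := by
  have hfin := h.finite
  intro y z
  refine eq_of_polarExt h.nondegenerate fun w => ?_
  -- With w = f₁(x), both pairings reduce to n(x • y, z) by associativity of the norm and the
  -- isometry property.
  obtain ⟨x, rfl⟩ := hs w
  rw [polarExt_comm, h1, ← polarExt_para h, polarExt_comm _ (f₁ x), ← polarExt_para h, ← hf, h0]

/-- Only the right factor need be even: its action keeps the second summand stable, and the block of
u is taken afterwards. -/
theorem rhoPlus_mul (u : R ⊗[F] CliffordAlgebra n) {v : R ⊗[F] CliffordAlgebra n}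
    (hv : v ∈ evenExt n R) : rhoPlus h R (u * v) = rhoPlus h R u * rhoPlus h R v :=
  LinearMap.ext fun x => by
    rw [rhoPlus_apply, map_mul, Module.End.mul_apply, cliffordRepExt_inrExt h hv,
      Module.End.mul_apply, rhoPlus_apply h u]

theorem rhoMinus_mul (u : R ⊗[F] CliffordAlgebra n) {v : R ⊗[F] CliffordAlgebra n}
    (hv : v ∈ evenExt n R) : rhoMinus h R (u * v) = rhoMinus h R u * rhoMinus h R v :=
  LinearMap.ext fun x => by
    rw [rhoMinus_apply, map_mul, Module.End.mul_apply, cliffordRepExt_inlExt h hv,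
      Module.End.mul_apply, rhoMinus_apply h u]

/-- Φ_R(τ(u)) is the adjoint of Φ_R(u), and τ(u) · u = 1. -/
theorem isometricEnd_rhoMinus {u : (R ⊗[F] CliffordAlgebra n)ˣ} (hu : u ∈ spin n R) :
    IsometricEnd n (rhoMinus h R u) := by
  intro x y
  have h1 := polarExt_cliffordRepExt h u (inlExt F C R x) (cliffordRepExt h R u (inlExt F C R y))
  rw [← Module.End.mul_apply, ← map_mul, tauExt_mul_self hu, cliffordRepExt_inlExt h hu.1,
    cliffordRepExt_inlExt h hu.1] at h1
  simpa using h1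

theorem isometricEnd_rhoPlus {u : (R ⊗[F] CliffordAlgebra n)ˣ} (hu : u ∈ spin n R) :
    IsometricEnd n (rhoPlus h R u) := by
  intro x y
  have h1 := polarExt_cliffordRepExt h u (inrExt F C R x) (cliffordRepExt h R u (inrExt F C R y))
  rw [← Module.End.mul_apply, ← map_mul, tauExt_mul_self hu, cliffordRepExt_inrExt h hu.1,
    cliffordRepExt_inrExt h hu.1] at h1
  simpa using h1

/-- The linear automorphism of `C_R` given by a multiplicative function on the spin group. -/
def spinUnit (ρ : R ⊗[F] CliffordAlgebra n → Module.End R (R ⊗[F] C)) (h1 : ρ 1 = 1)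
    (hm : ∀ u v, v ∈ evenExt n R → ρ (u * v) = ρ u * ρ v) (u : spin n R) :
    LinearMap.GeneralLinearGroup R (R ⊗[F] C) where
  val := ρ u.1.1
  inv := ρ (u⁻¹).1.1
  val_inv := by
    rw [← hm _ _ (u⁻¹).2.1, ← h1, ← Units.val_mul, ← Subgroup.coe_mul, mul_inv_cancel]; rfl
  inv_val := by
    rw [← hm _ _ u.2.1, ← h1, ← Units.val_mul, ← Subgroup.coe_mul, inv_mul_cancel]; rfl

/-- The linear automorphism `χ_u` of `C_R`. -/
def chiUnit (u : spin n R) : LinearMap.GeneralLinearGroup R (R ⊗[F] C) where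
  val := chi u.1
  inv := chi (u⁻¹).1
  val_inv := by
    rw [← chi_mul u.2 (u⁻¹).2, ← Subgroup.coe_mul, mul_inv_cancel]; exact chi_one
  inv_val := by
    rw [← chi_mul (u⁻¹).2 u.2, ← Subgroup.coe_mul, inv_mul_cancel]; exact chi_one

/-- The triple `(χ_u, ρ⁺_u, ρ⁻_u)`. -/
def trialityTriple (u : spin n R) : GLTriple F C R :=
  (chiUnit u, spinUnit (rhoPlus h R) (rhoPlus_one h) (fun u _ hv => rhoPlus_mul h u hv) u,
    spinUnit (rhoMinus h R) (rhoMinus_one h) (fun u _ hv => rhoMinus_mul h u hv) u)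

/-- Applying Φ_R to χ_u(y) · u = u · y on the first summand relates (ρ⁺, ρ⁻, χ); two rotations bring
χ to the front. -/
theorem related_trialityTriple (u : spin n R) :
    Related n (chi u.1) (rhoPlus h R u.1) (rhoMinus h R u.1) := by
  have h1 : Related n (rhoPlus h R u.1) (rhoMinus h R u.1) (chi u.1) := by
    intro x y
    have e : iotaExt n R (chi u.1 y) * u.1 = u.1 * iotaExt n R y := by
      rw [iotaExt_chi u.2, mul_assoc, Units.inv_mul, mul_one]
    have e1 := LinearMap.congr_fun (congrArg (cliffordRepExt h R) e) (inlExt F C R x)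
    rw [map_mul, map_mul, Module.End.mul_apply, Module.End.mul_apply,
      cliffordRepExt_inlExt h u.2.1, cliffordRepExt_iotaExt_inlExt,
      cliffordRepExt_iotaExt_inlExt, cliffordRepExt_inrExt h u.2.1] at e1
    have e2 := congrArg (sndExt F C R) e1
    rw [sndExt_inrExt, sndExt_inrExt] at e2
    exact e2.symm
  have h2 := h1.rotate h (isometricEnd_rhoPlus h u.2) (isometricEnd_rhoMinus h u.2)
    (GL_surjective (trialityTriple h u).2.2)
  exact h2.rotate h (isometricEnd_rhoMinus h u.2) (isometry_iff_polarExt.1 (baseChange_chi u.2))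
    (GL_surjective (chiUnit u))

/-- Surjectivity of Φ_R realizes the block-diagonal operator with blocks f₂, f₁ by some u.
Block-diagonality makes u even, the isometry property gives τ(u) · u = 1, and the two rotated
relations say that u · x · u⁻¹ = f₀(x). Determinants play no role. -/
theorem exists_spin_of_related {f₀ f₁ f₂ : LinearMap.GeneralLinearGroup R (R ⊗[F] C)}
    (hf : Related n f₀.1 f₁.1 f₂.1) (h0 : IsometricEnd n f₀.1) (h1 : IsometricEnd n f₁.1)
    (h2 : IsometricEnd n f₂.1) :
    ∃ u : spin n R, f₀.1 = chi u.1 ∧ f₁.1 = rhoPlus h R u.1 ∧ f₂.1 = rhoMinus h R u.1 := by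
  have hfin := h.finite
  have hr1 := hf.rotate h h0 h1 (GL_surjective f₁)
  have hr2 := hr1.rotate h h1 h2 (GL_surjective f₂)
  let D : Module.End R (R ⊗[F] C) → Module.End R (R ⊗[F] C) → Module.End R (R ⊗[F] (C × C)) :=
    fun a b => inlExt F C R ∘ₗ a ∘ₗ fstExt F C R + inrExt F C R ∘ₗ b ∘ₗ sndExt F C R
  have Dl : ∀ a b x, D a b (inlExt F C R x) = inlExt F C R (a x) := fun a b x => by simp [D]
  have Dr : ∀ a b x, D a b (inrExt F C R x) = inrExt F C R (b x) := fun a b x => by simp [D]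
  have DD : ∀ a b a' b', a * a' = 1 → b * b' = 1 → D a b * D a' b' = 1 := by
    intro a b a' b' ha hb
    refine endExt_ext (fun x => ?_) fun x => ?_
    · rw [Module.End.mul_apply, Dl, Dl, ← Module.End.mul_apply, ha]; rfl
    · rw [Module.End.mul_apply, Dr, Dr, ← Module.End.mul_apply, hb]; rfl
  have hbij := cliffordRepExt_bijective (R := R) h
  obtain ⟨a, ha⟩ := hbij.2 (D f₂.1 f₁.1)
  obtain ⟨a', ha'⟩ := hbij.2 (D f₂⁻¹.1 f₁⁻¹.1)
  let u : (R ⊗[F] CliffordAlgebra n)ˣ :=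
    { val := a
      inv := a'
      val_inv := hbij.1 (by rw [map_mul, ha, ha', map_one, DD _ _ _ _ f₂.mul_inv f₁.mul_inv])
      inv_val := hbij.1 (by rw [map_mul, ha, ha', map_one, DD _ _ _ _ f₂.inv_mul f₁.inv_mul]) }
  have hal : ∀ x, cliffordRepExt h R a (inlExt F C R x) = inlExt F C R (f₂.1 x) := fun x => by
    rw [ha, Dl]
  have har : ∀ x, cliffordRepExt h R a (inrExt F C R x) = inrExt F C R (f₁.1 x) := fun x => by
    rw [ha, Dr]
  have heven : a ∈ evenExt n R := by
    refine mem_evenExt_iff.2 (hbij.1 (endExt_ext (fun x => ?_) fun x => ?_))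
    · have e := gradeOp_cliffordRepExt h a (inlExt F C R x)
      rw [hal, gradeOp_baseChange, gradeOp_baseChange] at e
      simpa [hal] using e.symm
    · have e := gradeOp_cliffordRepExt h a (inrExt F C R x)
      rw [har, gradeOp_baseChange, gradeOp_baseChange] at e
      simpa [har] using e.symm
  have hplus : f₁.1 = rhoPlus h R a := LinearMap.ext fun x => by
    rw [rhoPlus_apply, har, sndExt_inrExt]
  have hminus : f₂.1 = rhoMinus h R a := LinearMap.ext fun x => by
    rw [rhoMinus_apply, hal, fstExt_inlExt]
  have htau : tauExt n R a * a = 1 := by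
    -- Each component is paired with a test vector x; adjointness moves Φ_R(τ(a)) over as Φ_R(a),
    -- whose block on x is an isometry.
    refine hbij.1 (LinearMap.ext fun p => prodExt_ext ?_ ?_)
    · refine eq_of_polarExt h.nondegenerate fun x => ?_
      have e := polarExt_cliffordRepExt h a (inlExt F C R x) (cliffordRepExt h R a p)
      rw [← Module.End.mul_apply, ← map_mul, ← inlExt_fstExt_add p, map_add, hal, har, hal] at e
      rw [← inlExt_fstExt_add p]
      simpa [polarExt_comm _ x, h2 x] using e.symm
    · refine eq_of_polarExt h.nondegenerate fun x => ?_
      have e := polarExt_cliffordRepExt h a (inrExt F C R x) (cliffordRepExt h R a p)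
      rw [← Module.End.mul_apply, ← map_mul, ← inlExt_fstExt_add p, map_add, hal, har, har] at e
      rw [← inlExt_fstExt_add p]
      simpa [polarExt_comm _ x, h1 x] using e.symm
  have hconj : ∀ x, (u : R ⊗[F] CliffordAlgebra n) * iotaExt n R x * ↑u⁻¹ =
      iotaExt n R (f₀.1 x) := by
    intro x
    rw [Units.mul_inv_eq_iff_eq_mul]
    -- Under Φ_R, the identity u · x = f₀(x) · u is `hr1` on the first summand and `hr2` on the
    -- second.
    refine hbij.1 ?_
    rw [map_mul, map_mul]
    refine endExt_ext (fun y => ?_) fun y => ?_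
    · rw [Module.End.mul_apply, Module.End.mul_apply, cliffordRepExt_iotaExt_inlExt]
      change cliffordRepExt h R a _ = cliffordRepExt h R _ (cliffordRepExt h R a _)
      rw [har, hal, cliffordRepExt_iotaExt_inlExt, hr1]
    · rw [Module.End.mul_apply, Module.End.mul_apply, cliffordRepExt_iotaExt_inrExt]
      change cliffordRepExt h R a _ = cliffordRepExt h R _ (cliffordRepExt h R a _)
      rw [har, hal, cliffordRepExt_iotaExt_inrExt, hr2]
  have hu : u ∈ spin n R := by
    refine ⟨heven, ?_, ?_⟩
    -- Since a already has the inverse a', the one-sided relation τ(a) · a = 1 suffices.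
    · have e : tauExt n R a = a' := left_inv_eq_right_inv htau u.val_inv
      change a * tauExt n R a = 1
      rw [e]
      exact u.val_inv
    · ext y
      constructor
      · rintro ⟨_, ⟨x, rfl⟩, rfl⟩
        exact ⟨f₀.1 x, (hconj x).symm⟩
      · rintro ⟨x, rfl⟩
        obtain ⟨z, rfl⟩ := GL_surjective f₀ x
        exact ⟨_, ⟨z, rfl⟩, hconj z⟩
  refine ⟨⟨u, hu⟩, LinearMap.ext fun x => iotaExt_injective (q := n) ?_, hplus, hminus⟩
  rw [iotaExt_chi hu, hconj]

/-- The members of a related triple of isometries have determinant one. -/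
theorem Related.det_eq_one (h : IsCayley n)
    {f₀ f₁ f₂ : LinearMap.GeneralLinearGroup R (R ⊗[F] C)}
    (hf : Related n f₀.1 f₁.1 f₂.1) (h0 : IsometricEnd n f₀.1) (h1 : IsometricEnd n f₁.1)
    (h2 : IsometricEnd n f₂.1) : LinearMap.det f₀.1 = 1 := by
  have hfin := h.finite
  -- The triple comes from a spin element, so f₀ is some χ_u, and 8 is even.
  obtain ⟨u, hu, -, -⟩ := exists_spin_of_related h hf h0 h1 h2
  rw [hu]
  exact det_chi h.nondegenerate (by rw [h.finrank_eq]; decide) u.2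

/-- Rotation brings each member to the first place, where its determinant is known. -/
theorem mem_relatedTriples_of_isometric (h : IsCayley n) {f : GLTriple F C R}
    (hf : Related n f.1.1 f.2.1.1 f.2.2.1) (h0 : IsometricEnd n f.1.1)
    (h1 : IsometricEnd n f.2.1.1) (h2 : IsometricEnd n f.2.2.1) : f ∈ relatedTriples n R := by
  have hr1 := hf.rotate h h0 h1 (GL_surjective _)
  have hr2 := hr1.rotate h h1 h2 (GL_surjective _)
  exact ⟨⟨isometry_iff_polarExt.2 h0, Related.det_eq_one h hf h0 h1 h2⟩,
    ⟨isometry_iff_polarExt.2 h1, Related.det_eq_one h hr1 h1 h2 h0⟩,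
    ⟨isometry_iff_polarExt.2 h2, Related.det_eq_one h hr2 h2 h0 h1⟩, hf⟩

theorem trialityTriple_mem (u : spin n R) : trialityTriple h u ∈ relatedTriples n R :=
  mem_relatedTriples_of_isometric h (related_trialityTriple h u)
    (isometry_iff_polarExt.1 (baseChange_chi u.2)) (isometricEnd_rhoPlus h u.2)
    (isometricEnd_rhoMinus h u.2)

/-- The homomorphism `u ↦ (χ_u, ρ⁺_u, ρ⁻_u)` on `R`-points. -/
def trialityHom (R : Type w) [CommRing R] [Algebra F R] : spin n R →* relatedTriples n R where
  toFun u := ⟨trialityTriple h u, trialityTriple_mem h u⟩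
  map_one' := Subtype.ext (Prod.ext (Units.ext chi_one)
    (Prod.ext (Units.ext (rhoPlus_one h)) (Units.ext (rhoMinus_one h))))
  map_mul' u v := Subtype.ext (Prod.ext (Units.ext (chi_mul u.2 v.2))
    (Prod.ext (Units.ext (rhoPlus_mul h _ v.2.1)) (Units.ext (rhoMinus_mul h _ v.2.1))))

theorem isTrialityTriple_trialityHom (u : spin n R) : IsTrialityTriple h u (trialityHom h R u) :=
  ⟨iotaExt_chi u.2, rfl, rfl⟩

/-- Naturality rests on this: it suffices that the base change of a triple satisfies the equations
for the base change of u. -/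
theorem IsTrialityTriple.unique {u : spin n R} {f g : relatedTriples n R}
    (hf : IsTrialityTriple h u f) (hg : IsTrialityTriple h u g) : f = g := by
  refine Subtype.ext (Prod.ext (Units.ext ?_) (Prod.ext (Units.ext ?_) (Units.ext ?_)))
  · exact LinearMap.ext fun x => iotaExt_injective (q := n) ((hf.1 x).trans (hg.1 x).symm)
  · exact hf.2.1.trans hg.2.1.symm
  · exact hf.2.2.trans hg.2.2.symm

/-- Φ_R is injective and an even element acts block-diagonally, so ρ⁺ and ρ⁻ alone determine u. -/
theorem trialityHom_bijective : Function.Bijective (trialityHom h R) := by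
  constructor
  · intro u v huv
    have h1 : rhoPlus h R u.1 = rhoPlus h R v.1 :=
      congrArg (fun f : relatedTriples n R => f.1.2.1.1) huv
    have h2 : rhoMinus h R u.1 = rhoMinus h R v.1 :=
      congrArg (fun f : relatedTriples n R => f.1.2.2.1) huv
    refine Subtype.ext (Units.ext ((cliffordRepExt_bijective h).1 (endExt_ext (fun x => ?_)
      fun x => ?_)))
    · rw [cliffordRepExt_inlExt h u.2.1, cliffordRepExt_inlExt h v.2.1, h2]
    · rw [cliffordRepExt_inrExt h u.2.1, cliffordRepExt_inrExt h v.2.1, h1]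
  · rintro ⟨f, h0, h1, h2, hf⟩
    obtain ⟨u, e0, e1, e2⟩ := exists_spin_of_related h hf (isometry_iff_polarExt.1 h0.1)
      (isometry_iff_polarExt.1 h1.1) (isometry_iff_polarExt.1 h2.1)
    exact ⟨u, Subtype.ext (Prod.ext (Units.ext e0.symm)
      (Prod.ext (Units.ext e1.symm) (Units.ext e2.symm)))⟩

end Triality

/-! ### Ψ identifies Cl(C₀, -n) with the even part of Cl(C, n) -/

section EvenClifford

open CliffordAlgebra

variable {F : Type u} [Field F]
variable {C : Type v} [NonAssocRing C] [Module F C]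

theorem ι_mul_ι_one {n : QuadraticForm F C} (x : traceZero n) : ι n (x : C) * ι n 1 = -(ι n 1 * ι n (x : C)) :=
  ι_mul_ι_of_polar_eq_zero x.2

/-- Half the trace, the coefficient of the unity. -/
def scalarPart [Invertible (2 : F)] (n : QuadraticForm F C) : C →ₗ[F] F :=
  (⅟2 : F) • (QuadraticMap.polarBilin n).flip 1

theorem scalarPart_coe [Invertible (2 : F)] {n : QuadraticForm F C}
    (x : traceZero n) : scalarPart n (x : C) = 0 := by
  change ⅟2 * QuadraticMap.polar n (x : C) 1 = 0
  rw [show QuadraticMap.polar n (x : C) 1 = 0 from x.2, mul_zero]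

variable [SMulCommClass F C C] [IsScalarTower F C C]
variable {n : QuadraticForm F C} (h : IsCayley n)

theorem cliffordEmb_ι (x : traceZero n) :
    cliffordEmb h (ι (negNorm n) x) = ι n 1 * ι n (x : C) := by
  rw [cliffordEmb, lift_ι_apply]
  rfl

theorem ι_one_mul_self (h : IsCayley n) : ι n 1 * ι n 1 = 1 := by
  rw [ι_sq_scalar, h.norm_one, map_one]

theorem cliffordEmb_mem_even (x : CliffordAlgebra (negNorm n)) : cliffordEmb h x ∈ even n := by
  induction x using CliffordAlgebra.induction with
  | algebraMap r => rw [AlgHom.commutes]; exact (even n).algebraMap_mem r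
  | ι x => rw [cliffordEmb_ι]; exact ι_mul_ι_mem_evenOdd_zero n _ _
  | mul x y hx hy => rw [map_mul]; exact (even n).mul_mem hx hy
  | add x y hx hy => rw [map_add]; exact (even n).add_mem hx hy

/-- For x ∈ C₀ the element e₀ · x anticommutes with e₀. Parity in Cl(C₀, -n) is thereby seen in
Cl(C, n) as commutation with e₀. -/
theorem cliffordEmb_involute (x : CliffordAlgebra (negNorm n)) :
    cliffordEmb h (involute x) * ι n 1 = ι n 1 * cliffordEmb h x := by
  induction x using CliffordAlgebra.induction with
  | algebraMap r => simp [Algebra.commutes]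
  | ι x =>
    rw [involute_ι, map_neg, cliffordEmb_ι, neg_mul, mul_assoc, ι_mul_ι_one, mul_neg, neg_neg]
  | mul x y hx hy => rw [map_mul, map_mul, map_mul, mul_assoc, hy, ← mul_assoc, hx, mul_assoc]
  | add x y hx hy => rw [map_add, map_add, add_mul, hx, hy, map_add, mul_add]

/-- τ(e₀ · x) = x · e₀ = -e₀ · x for x ∈ C₀, so the involutions agree under Ψ only up to the grade
involution, which is trivial on even elements. -/
theorem reverse_cliffordEmb (x : CliffordAlgebra (negNorm n)) :
    reverse (cliffordEmb h x) = cliffordEmb h (reverse (involute x)) := by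
  induction x using CliffordAlgebra.induction with
  | algebraMap r => simp
  | ι x =>
    rw [involute_ι, map_neg, map_neg, reverse_ι, cliffordEmb_ι, reverse.map_mul, reverse_ι,
      reverse_ι, ι_mul_ι_one]
  | mul x y hx hy => simp only [map_mul, reverse.map_mul, hx, hy]
  | add x y hx hy => simp only [map_add, hx, hy]

theorem polar_one_one (h : IsCayley n) : QuadraticMap.polar n (1 : C) 1 = 2 := by
  rw [QuadraticMap.polar_self, h.norm_one]; simp

variable [Invertible (2 : F)]

/-- The projection of `C` to `C₀` along the unity. -/
def tracelessPart (h : IsCayley n) : C →ₗ[F] traceZero n :=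
  LinearMap.codRestrict (traceZero n) (LinearMap.id - (scalarPart n).smulRight 1) fun x => by
    change QuadraticMap.polar n (x - (⅟2 * QuadraticMap.polar n x 1) • (1 : C)) 1 = 0
    rw [QuadraticMap.polar_sub_left, QuadraticMap.polar_smul_left, polar_one_one h, smul_eq_mul,
      mul_right_comm, invOf_mul_self, one_mul, sub_self]

theorem scalarPart_smul_add (x : C) :
    scalarPart n x • (1 : C) + (tracelessPart h x : C) = x := by
  change scalarPart n x • (1 : C) + (x - scalarPart n x • (1 : C)) = x
  abel

theorem scalarPart_one (h : IsCayley n) : scalarPart n (1 : C) = 1 := by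
  change ⅟2 * QuadraticMap.polar n (1 : C) 1 = 1
  rw [polar_one_one h, invOf_mul_self]

theorem tracelessPart_one : tracelessPart h (1 : C) = 0 := by
  refine Subtype.ext ?_
  change (1 : C) - scalarPart n (1 : C) • (1 : C) = 0
  rw [scalarPart_one h, one_smul, sub_self]

theorem tracelessPart_coe (x : traceZero n) : tracelessPart h (x : C) = x := by
  refine Subtype.ext ?_
  change (x : C) - scalarPart n (x : C) • (1 : C) = x
  rw [scalarPart_coe, zero_smul, sub_zero]

theorem norm_eq (x : C) : n x = scalarPart n x ^ 2 - negNorm n (tracelessPart h x) := by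
  change n x = scalarPart n x ^ 2 - -n (tracelessPart h x : C)
  conv_lhs => rw [← scalarPart_smul_add h x]
  rw [QuadraticMap.map_add n, QuadraticMap.polar_smul_left, QuadraticMap.polar_comm,
    show QuadraticMap.polar n (tracelessPart h x : C) 1 = 0 from (tracelessPart h x).2,
    QuadraticMap.map_smul, h.norm_one]
  simp [sq]

/-- The left factor `a - x₀` attached to the vector `a + x₀`. -/
def leftFactor : C →ₗ[F] CliffordAlgebra (negNorm n) :=
  Algebra.linearMap F _ ∘ₗ scalarPart n - ι (negNorm n) ∘ₗ tracelessPart h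

/-- The right factor `a + x₀` attached to the vector `a + x₀`. -/
def rightFactor : C →ₗ[F] CliffordAlgebra (negNorm n) :=
  Algebra.linearMap F _ ∘ₗ scalarPart n + ι (negNorm n) ∘ₗ tracelessPart h

theorem leftFactor_apply (x : C) : leftFactor h x =
    algebraMap F _ (scalarPart n x) - ι (negNorm n) (tracelessPart h x) := rfl

theorem rightFactor_apply (x : C) : rightFactor h x =
    algebraMap F _ (scalarPart n x) + ι (negNorm n) (tracelessPart h x) := rfl

/-- For x = a + x₀ one has x · e₀ = Ψ(a - x₀) and e₀ · x = Ψ(a + x₀). As e₀ · e₀ = 1, a product x ·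
y of two vectors is (x · e₀) · (e₀ · y), which explains the two factors; the relations needed for
the inverse of Ψ reflect x · x = n(x). -/
theorem leftFactor_mul_rightFactor (x : C) :
    leftFactor h x * rightFactor h x = algebraMap F _ (n x) := by
  rw [norm_eq h, leftFactor_apply, rightFactor_apply, map_sub, ← ι_sq_scalar, map_pow, sq, sub_mul,
    mul_add, mul_add, Algebra.commutes (scalarPart n x) (ι (negNorm n) (tracelessPart h x))]
  abel

theorem rightFactor_mul_leftFactor (x : C) :
    rightFactor h x * leftFactor h x = algebraMap F _ (n x) := by
  rw [norm_eq h, leftFactor_apply, rightFactor_apply, map_sub, ← ι_sq_scalar, map_pow, sq, add_mul,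
    mul_sub, mul_sub, Algebra.commutes (scalarPart n x) (ι (negNorm n) (tracelessPart h x))]
  abel

/-- The homomorphism from the even Clifford algebra of `n` to `Cl(C₀, -n)` that is inverse
to `Ψ`. -/
def evenToTraceless : even n →ₐ[F] CliffordAlgebra (negNorm n) :=
  even.lift n
    { bilin := (LinearMap.mul F _).compl₁₂ (leftFactor h) (rightFactor h)
      contract := leftFactor_mul_rightFactor h
      contract_mid := fun x y z => by
        change leftFactor h x * rightFactor h y * (leftFactor h y * rightFactor h z) =
          n y • (leftFactor h x * rightFactor h z)
        rw [mul_assoc, ← mul_assoc (rightFactor h y), rightFactor_mul_leftFactor,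
          ← Algebra.smul_def, mul_smul_comm] }

theorem evenToTraceless_ι (x y : C) :
    evenToTraceless h ((even.ι n).bilin x y) = leftFactor h x * rightFactor h y :=
  even.lift_ι _ _ _ _

/-- `Ψ`, with values in the even Clifford algebra. -/
def cliffordEmbEven : CliffordAlgebra (negNorm n) →ₐ[F] even n :=
  (cliffordEmb h).codRestrict (even n) (cliffordEmb_mem_even h)

theorem evenToTraceless_cliffordEmbEven (x : CliffordAlgebra (negNorm n)) :
    evenToTraceless h (cliffordEmbEven h x) = x := by
  have e : (evenToTraceless h).comp (cliffordEmbEven h) = AlgHom.id F _ := by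
    refine CliffordAlgebra.hom_ext (LinearMap.ext fun x => ?_)
    have e1 : cliffordEmbEven h (ι (negNorm n) x) = (even.ι n).bilin 1 (x : C) :=
      Subtype.ext (cliffordEmb_ι h x)
    change evenToTraceless h (cliffordEmbEven h (ι (negNorm n) x)) = ι (negNorm n) x
    rw [e1, evenToTraceless_ι, leftFactor_apply, rightFactor_apply, scalarPart_one h,
      tracelessPart_one, scalarPart_coe, tracelessPart_coe]
    simp
  exact DFunLike.congr_fun e x

theorem cliffordEmbEven_evenToTraceless (x : even n) :
    cliffordEmbEven h (evenToTraceless h x) = x := by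
  have e : (cliffordEmbEven h).comp (evenToTraceless h) = AlgHom.id F _ := by
    -- The even subalgebra is generated by the products of two vectors.
    refine even.algHom_ext n (EvenHom.ext (LinearMap.ext₂ fun x y => Subtype.ext ?_))
    change cliffordEmb h (evenToTraceless h ((even.ι n).bilin x y)) = ι n x * ι n y
    rw [evenToTraceless_ι, map_mul, leftFactor_apply, rightFactor_apply, map_sub, map_add,
      AlgHom.commutes, AlgHom.commutes, cliffordEmb_ι, cliffordEmb_ι]
    conv_rhs => rw [← scalarPart_smul_add h x, ← scalarPart_smul_add h y]
    rw [map_add, map_add, map_smul, map_smul, Algebra.smul_def, Algebra.smul_def,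
      sub_eq_add_neg, ← ι_mul_ι_one]
    have e0 := ι_one_mul_self h
    have e1 : ∀ a b : CliffordAlgebra n, a * ι n 1 * (ι n 1 * b) = a * b := fun a b => by
      rw [mul_assoc, ← mul_assoc (ι n 1), e0, one_mul]
    rw [Algebra.commutes (scalarPart n y) (ι n 1)]
    simp only [mul_add, add_mul, e1]
    simp only [mul_assoc]
  exact DFunLike.congr_fun e x

end EvenClifford

/-! ### The spin group of C₀ as the stabilizer of e₀ -/

section Extension

open CliffordAlgebra

variable {F : Type u} [Field F]
variable {C : Type v} [NonAssocRing C] [Module F C]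
variable {n : QuadraticForm F C} {R : Type w} [CommRing R] [Algebra F R]

/-- The unity of `C`, as a vector in `Cl(C, n)_R`. -/
def unityExt (n : QuadraticForm F C) (R : Type w) [CommRing R] [Algebra F R] :
    R ⊗[F] CliffordAlgebra n :=
  1 ⊗ₜ ι n 1

/-- The inclusion of `(C₀)_R` in `C_R`. -/
def traceZeroIncl (n : QuadraticForm F C) (R : Type w) [CommRing R] [Algebra F R] :
    R ⊗[F] traceZero n →ₗ[R] R ⊗[F] C :=
  (traceZero n).subtype.baseChange R

theorem iotaExt_one_tmul_one : iotaExt n R (1 ⊗ₜ 1) = unityExt n R := rfl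

theorem polarExt_traceZeroIncl (x : R ⊗[F] traceZero n) :
    polarExt n R (traceZeroIncl n R x) (1 ⊗ₜ 1) = 0 := by
  induction x using TensorProduct.induction_on with
  | zero => simp
  | add x y hx hy => simp only [map_add, LinearMap.add_apply, hx, hy, add_zero]
  | tmul r x =>
    change polarExt n R (r ⊗ₜ (x : C)) (1 ⊗ₜ 1) = 0
    rw [polarExt_tmul, show QuadraticMap.polar n (x : C) 1 = 0 from x.2, map_zero, mul_zero]

variable [SMulCommClass F C C] [IsScalarTower F C C] (h : IsCayley n)

theorem cliffordEmbExt_tmul (r : R) (x : CliffordAlgebra (negNorm n)) :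
    cliffordEmbExt h R (r ⊗ₜ x) = r ⊗ₜ cliffordEmb h x := rfl

theorem unityExt_mul_self (h : IsCayley n) : unityExt n R * unityExt n R = 1 := by
  rw [unityExt, Algebra.TensorProduct.tmul_mul_tmul, ι_one_mul_self h, mul_one]
  rfl

theorem cliffordEmbExt_involuteExt (x : R ⊗[F] CliffordAlgebra (negNorm n)) :
    cliffordEmbExt h R (involuteExt _ R x) * unityExt n R =
      unityExt n R * cliffordEmbExt h R x := by
  induction x using TensorProduct.induction_on with
  | zero => simp
  | add x y hx hy => simp only [map_add, add_mul, mul_add, hx, hy]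
  | tmul r x =>
    simp [unityExt, cliffordEmbExt_tmul, cliffordEmb_involute]

theorem tauExt_cliffordEmbExt (x : R ⊗[F] CliffordAlgebra (negNorm n)) :
    tauExt n R (cliffordEmbExt h R x) =
      cliffordEmbExt h R (tauExt _ R (involuteExt _ R x)) := by
  induction x using TensorProduct.induction_on with
  | zero => simp
  | add x y hx hy => simp only [map_add, hx, hy]
  | tmul r x => simp [cliffordEmbExt_tmul, reverse_cliffordEmb]

theorem cliffordEmbExt_iotaExt (x : R ⊗[F] traceZero n) :
    cliffordEmbExt h R (iotaExt (negNorm n) R x) =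
      unityExt n R * iotaExt n R (traceZeroIncl n R x) := by
  induction x using TensorProduct.induction_on with
  | zero => simp
  | add x y hx hy => simp only [map_add, mul_add, hx, hy]
  | tmul r x => simp [unityExt, traceZeroIncl, cliffordEmbExt_tmul, cliffordEmb_ι]

theorem cliffordEmbExt_mul_unityExt {x : R ⊗[F] CliffordAlgebra (negNorm n)}
    (hx : x ∈ evenExt _ R) :
    cliffordEmbExt h R x * unityExt n R = unityExt n R * cliffordEmbExt h R x := by
  rw [← cliffordEmbExt_involuteExt, involuteExt_of_mem_evenExt hx]

variable [Invertible (2 : F)]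

/-- Ψ into the even part has a left inverse, which persists over R; the inclusion of the even part
stays injective because R is flat over F. -/
theorem cliffordEmbExt_injective : Function.Injective (cliffordEmbExt h R) := by
  let E : R ⊗[F] CliffordAlgebra (negNorm n) →ₗ[R] R ⊗[F] even n :=
    (cliffordEmbEven h).toLinearMap.baseChange R
  have hE : Function.Injective E := by
    refine Function.LeftInverse.injective
      (g := (evenToTraceless h).toLinearMap.baseChange R) fun x => ?_
    induction x using TensorProduct.induction_on with
    | zero => simp
    | add x y hx hy => simp only [map_add, hx, hy]
    | tmul r x => simp [E, evenToTraceless_cliffordEmbEven]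
  have hs : Function.Injective ((even n).val.toLinearMap.baseChange R) :=
    Module.Flat.lTensor_preserves_injective_linearMap _ Subtype.val_injective
  have e : ∀ x, cliffordEmbExt h R x = (even n).val.toLinearMap.baseChange R (E x) := by
    intro x
    induction x using TensorProduct.induction_on with
    | zero => simp
    | add x y hx hy => simp only [map_add, hx, hy]
    | tmul r x => rfl
  intro x y hxy
  rw [e, e] at hxy
  exact hE (hs hxy)

theorem mem_evenExt_iff_exists_cliffordEmbExt {u : R ⊗[F] CliffordAlgebra n} :
    u ∈ evenExt n R ↔ ∃ x, cliffordEmbExt h R x = u := by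
  constructor
  · intro hu
    refine induction_evenExt (P := fun u => ∃ x, cliffordEmbExt h R x = u) ⟨0, map_zero _⟩
      ?_ ?_ u hu
    · rintro _ _ ⟨x, rfl⟩ ⟨y, rfl⟩
      exact ⟨x + y, map_add _ _ _⟩
    · intro r a ha
      refine ⟨r ⊗ₜ evenToTraceless h ⟨a, ha⟩, ?_⟩
      rw [cliffordEmbExt_tmul]
      exact congrArg (r ⊗ₜ[F] ·)
        (congrArg Subtype.val (cliffordEmbEven_evenToTraceless h ⟨a, ha⟩))
  · rintro ⟨x, rfl⟩
    induction x using TensorProduct.induction_on with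
    | zero => simp
    | add x y hx hy => rw [map_add]; exact add_mem hx hy
    | tmul r x => exact tmul_mem_evenExt r (cliffordEmb_mem_even h x)

theorem exists_eq_smul_add (h : IsCayley n) (x : R ⊗[F] C) :
    ∃ (r : R) (y : R ⊗[F] traceZero n), x = r ⊗ₜ 1 + traceZeroIncl n R y := by
  induction x using TensorProduct.induction_on with
  | zero => exact ⟨0, 0, by simp⟩
  | add x y hx hy =>
    obtain ⟨r, z, rfl⟩ := hx
    obtain ⟨s, t, rfl⟩ := hy
    exact ⟨r + s, z + t, by rw [add_tmul, map_add]; abel⟩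
  | tmul r x =>
    refine ⟨scalarPart n x • r, r ⊗ₜ tracelessPart h x, ?_⟩
    change r ⊗ₜ x = _ + r ⊗ₜ (tracelessPart h x : C)
    rw [smul_tmul, ← tmul_add, scalarPart_smul_add]

theorem exists_traceZeroIncl_eq (h : IsCayley n) {x : R ⊗[F] C}
    (hx : polarExt n R x (1 ⊗ₜ 1) = 0) : ∃ y, traceZeroIncl n R y = x := by
  obtain ⟨r, y, rfl⟩ := exists_eq_smul_add h x
  rw [map_add, LinearMap.add_apply, polarExt_traceZeroIncl, add_zero, polarExt_tmul,
    polar_one_one h, mul_one] at hx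
  have h2 : IsUnit (algebraMap F R 2) := (isUnit_of_invertible (2 : F)).map _
  have hr : r = 0 := h2.mul_left_eq_zero.1 hx
  exact ⟨y, by rw [hr, zero_tmul, zero_add]⟩

/-- Since u is even, Ψ(u) commutes with e₀. Conjugation by it fixes e₀ and sends x₀ = e₀ · Ψ(x₀) to
e₀ · Ψ(u · x₀ · u⁻¹), again a vector of C₀. -/
theorem map_cliffordEmbExt_mem_spin {u : (R ⊗[F] CliffordAlgebra (negNorm n))ˣ}
    (hu : u ∈ spin (negNorm n) R) :
    Units.map (cliffordEmbExt h R : R ⊗[F] CliffordAlgebra (negNorm n) →*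
      R ⊗[F] CliffordAlgebra n) u ∈ spin n R := by
  have hconj : ∀ v : (R ⊗[F] CliffordAlgebra (negNorm n))ˣ, v ∈ spin (negNorm n) R → ∀ x,
      cliffordEmbExt h R v * iotaExt n R x * cliffordEmbExt h R ↑v⁻¹ ∈
        Set.range (iotaExt n R) := by
    intro v hv x
    obtain ⟨r, y, rfl⟩ := exists_eq_smul_add h x
    have e1 : (v : R ⊗[F] CliffordAlgebra (negNorm n)) * iotaExt _ R y *
        ((v⁻¹ : (R ⊗[F] CliffordAlgebra (negNorm n))ˣ) : R ⊗[F] CliffordAlgebra (negNorm n)) ∈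
        Set.range (iotaExt (negNorm n) R) := by
      rw [← hv.2.2]
      exact ⟨_, ⟨y, rfl⟩, rfl⟩
    obtain ⟨z, hz⟩ := e1
    have e2 : cliffordEmbExt h R v * cliffordEmbExt h R ↑v⁻¹ = 1 := by
      rw [← map_mul, Units.mul_inv, map_one]
    refine ⟨r ⊗ₜ 1 + traceZeroIncl n R z, ?_⟩
    have e3 : (r ⊗ₜ[F] (1 : C) : R ⊗[F] C) = r • (1 ⊗ₜ 1) := by
      rw [TensorProduct.smul_tmul', smul_eq_mul, mul_one]
    rw [map_add, map_add, mul_add, add_mul, e3, map_smul, iotaExt_one_tmul_one, mul_smul_comm,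
      smul_mul_assoc, cliffordEmbExt_mul_unityExt h hv.1, mul_assoc (unityExt n R), e2, mul_one]
    congr 1
    have e4 := congrArg (fun t => unityExt n R * t) (congrArg (cliffordEmbExt h R) hz)
    simp only [map_mul, cliffordEmbExt_iotaExt] at e4
    rw [← mul_assoc, unityExt_mul_self h, one_mul] at e4
    rw [e4, ← mul_assoc (cliffordEmbExt h R v), cliffordEmbExt_mul_unityExt h hv.1]
    simp only [← mul_assoc]
    rw [unityExt_mul_self h, one_mul]
  refine ⟨(mem_evenExt_iff_exists_cliffordEmbExt h).2 ⟨_, rfl⟩, ?_, ?_⟩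
  · change cliffordEmbExt h R u * tauExt n R (cliffordEmbExt h R u) = 1
    rw [tauExt_cliffordEmbExt, involuteExt_of_mem_evenExt hu.1, ← map_mul, hu.2.1, map_one]
  · apply Set.Subset.antisymm
    · rintro _ ⟨_, ⟨x, rfl⟩, rfl⟩
      exact hconj u hu x
    · rintro _ ⟨x, rfl⟩
      obtain ⟨z, hz⟩ := hconj u⁻¹ (inv_mem hu) x
      refine ⟨_, ⟨z, rfl⟩, ?_⟩
      change cliffordEmbExt h R u * iotaExt n R z * cliffordEmbExt h R ↑u⁻¹ = _
      have e2 : cliffordEmbExt h R u * cliffordEmbExt h R ↑u⁻¹ = 1 := by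
        rw [← map_mul, Units.mul_inv, map_one]
      rw [hz, inv_inv, ← mul_assoc, ← mul_assoc, e2, one_mul, mul_assoc, e2, mul_one]

/-- The homomorphism of spin groups induced by `Ψ`, on `R`-points. -/
def spinEmb (R : Type w) [CommRing R] [Algebra F R] : spin (negNorm n) R →* spin n R :=
  ((Units.map (cliffordEmbExt h R : R ⊗[F] CliffordAlgebra (negNorm n) →*
      R ⊗[F] CliffordAlgebra n)).comp (spin (negNorm n) R).subtype).codRestrict (spin n R)
    fun u => map_cliffordEmbExt_mem_spin h u.2

theorem spinEmb_injective : Function.Injective (spinEmb h R) := fun _ _ huv =>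
  Subtype.ext (Units.ext (cliffordEmbExt_injective h
    (congrArg (fun w : spin n R => (w.1 : R ⊗[F] CliffordAlgebra n)) huv)))

theorem chi_spinEmb_one (u : spin (negNorm n) R) :
    chi (spinEmb h R u).1 (1 ⊗ₜ (1 : C)) = 1 ⊗ₜ (1 : C) := by
  refine iotaExt_injective (q := n) ?_
  rw [iotaExt_chi (spinEmb h R u).2, iotaExt_one_tmul_one, Units.mul_inv_eq_iff_eq_mul]
  exact cliffordEmbExt_mul_unityExt h u.2.1

/-- Being even, v is Ψ(a). Fixing e₀ means commuting with e₀, which makes a even, and the isometry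
χ_v then preserves the orthogonal complement of e₀, so a normalizes (C₀)_R. -/
theorem exists_spinEmb_eq {v : spin n R} (hv : chi v.1 (1 ⊗ₜ (1 : C)) = 1 ⊗ₜ (1 : C)) :
    ∃ u, spinEmb h R u = v := by
  have hcomm : ∀ w : spin n R, chi w.1 (1 ⊗ₜ (1 : C)) = 1 ⊗ₜ (1 : C) →
      (w.1 : R ⊗[F] CliffordAlgebra n) * unityExt n R = unityExt n R * w.1 := by
    intro w hw
    have e := iotaExt_chi w.2 (1 ⊗ₜ (1 : C))
    rw [hw, iotaExt_one_tmul_one, eq_comm, Units.mul_inv_eq_iff_eq_mul] at e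
    exact e
  obtain ⟨a, ha⟩ := (mem_evenExt_iff_exists_cliffordEmbExt h).1 v.2.1
  obtain ⟨a', ha'⟩ := (mem_evenExt_iff_exists_cliffordEmbExt h).1 (v⁻¹).2.1
  have hinj := cliffordEmbExt_injective (R := R) h
  let u : (R ⊗[F] CliffordAlgebra (negNorm n))ˣ :=
    { val := a
      inv := a'
      val_inv := hinj (by rw [map_mul, ha, ha', map_one]; exact v.1.mul_inv)
      inv_val := hinj (by rw [map_mul, ha, ha', map_one]; exact v.1.inv_mul) }
  have hinvol : involuteExt _ R a = a := by
    refine hinj ?_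
    -- Conjugating Ψ(a) by e₀ applies the involution to a; here it changes nothing.
    have e := cliffordEmbExt_involuteExt h a
    rw [ha, ← hcomm v hv] at e
    have e' := congrArg (fun t => t * unityExt n R) e
    simp only [mul_assoc, unityExt_mul_self h, mul_one] at e'
    rw [e', ha]
  have hiso : ∀ x y, polarExt n R (chi v.1 x) (chi v.1 y) = polarExt n R x y :=
    isometry_iff_polarExt.1 (baseChange_chi v.2)
  have hchi : ∀ x : R ⊗[F] traceZero n, ∃ z,
      traceZeroIncl n R z = chi v.1 (traceZeroIncl n R x) := fun x =>
    exists_traceZeroIncl_eq h (by rw [← hv, hiso, polarExt_traceZeroIncl])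
  have hconj : ∀ x z, traceZeroIncl n R z = chi v.1 (traceZeroIncl n R x) →
      a * iotaExt _ R x * a' = iotaExt (negNorm n) R z := by
    intro x z hz
    refine hinj ?_
    rw [map_mul, map_mul, ha, ha', cliffordEmbExt_iotaExt, cliffordEmbExt_iotaExt, hz,
      iotaExt_chi v.2, ← mul_assoc, hcomm v hv]
    simp only [mul_assoc]
    rfl
  refine ⟨⟨u, mem_evenExt_iff.2 hinvol, ?_, ?_⟩, Subtype.ext (Units.ext ha)⟩
  · refine hinj ?_
    change cliffordEmbExt h R (a * tauExt _ R a) = cliffordEmbExt h R 1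
    have e := tauExt_cliffordEmbExt h a
    rw [hinvol] at e
    rw [map_mul, ← e, ha, map_one]
    exact v.2.2.1
  · ext y
    constructor
    · rintro ⟨_, ⟨x, rfl⟩, rfl⟩
      obtain ⟨z, hz⟩ := hchi x
      exact ⟨z, (hconj x z hz).symm⟩
    · rintro ⟨z, rfl⟩
      obtain ⟨x, hx⟩ := GL_surjective (chiUnit v) (traceZeroIncl n R z)
      have hx' : chi v.1 x = traceZeroIncl n R z := hx
      -- The preimage is orthogonal to e₀ too, since χ_v is an isometry fixing e₀.
      obtain ⟨x', rfl⟩ := exists_traceZeroIncl_eq h (x := x)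
        (by rw [← hiso, hv, hx', polarExt_traceZeroIncl])
      exact ⟨_, ⟨x', rfl⟩, hconj x' z hx'.symm⟩

/-- The homomorphism `u ↦ (χ_{Ψ(u)}, ρ⁺_{Ψ(u)}, ρ⁻_{Ψ(u)})` on `R`-points. -/
def unityTrialityHom (R : Type w) [CommRing R] [Algebra F R] :
    spin (negNorm n) R →* unityTriples n R where
  toFun u := ⟨(trialityHom h R (spinEmb h R u)).1,
    (trialityHom h R (spinEmb h R u)).2, chi_spinEmb_one h u⟩
  map_one' := Subtype.ext (by simp)
  map_mul' u v := Subtype.ext (by simp)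

theorem unityTrialityHom_bijective : Function.Bijective (unityTrialityHom h R) := by
  constructor
  · intro u v huv
    exact spinEmb_injective h ((trialityHom_bijective h).1
      (Subtype.ext (congrArg (fun f : unityTriples n R => f.1) huv :)))
  · rintro ⟨f, hf, hf1⟩
    obtain ⟨v, hv⟩ := (trialityHom_bijective h).2 ⟨f, hf⟩
    have hv' := congrArg Subtype.val hv
    obtain ⟨u, rfl⟩ := exists_spinEmb_eq h (v := v) (by
      have e : chi v.1 = f.1.1 := congrArg (fun g : GLTriple F C R => g.1.1) hv'
      rw [e, hf1])
    exact ⟨u, Subtype.ext hv'⟩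

end Extension

/-! ### Compatibility with base change -/

section Naturality

open CliffordAlgebra

variable {F : Type u} [Field F]
variable {R : Type w} [CommRing R] [Algebra F R] {S : Type w'} [CommRing S] [Algebra F S]

@[simp] theorem cliffordMap_tmul {V : Type v} [AddCommGroup V] [Module F V] (φ : R →ₐ[F] S)
    (q : QuadraticForm F V) (r : R) (x : CliffordAlgebra q) :
    cliffordMap φ q (r ⊗ₜ x) = φ r ⊗ₜ x := rfl

theorem iotaExt_scalarMap {V : Type v} [AddCommGroup V] [Module F V] (φ : R →ₐ[F] S)
    (q : QuadraticForm F V) (x : R ⊗[F] V) :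
    iotaExt q S (scalarMap φ V x) = cliffordMap φ q (iotaExt q R x) := by
  induction x using TensorProduct.induction_on with
  | zero => simp
  | add x y hx hy => simp only [map_add, hx, hy]
  | tmul r v => simp

variable {C : Type v} [NonAssocRing C] [Module F C] [SMulCommClass F C C] [IsScalarTower F C C]
variable {n : QuadraticForm F C} (h : IsCayley n) (φ : R →ₐ[F] S)

theorem scalarMap_cliffordRepExt (u : R ⊗[F] CliffordAlgebra n) (p : R ⊗[F] (C × C)) :
    scalarMap φ (C × C) (cliffordRepExt h R u p) =
      cliffordRepExt h S (cliffordMap φ n u) (scalarMap φ (C × C) p) := by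
  induction u using TensorProduct.induction_on with
  | zero => simp
  | add x y hx hy => simp only [map_add, LinearMap.add_apply, hx, hy]
  | tmul r x =>
    induction p using TensorProduct.induction_on with
    | zero => simp
    | add x y hx hy => simp only [map_add, hx, hy]
    | tmul s c => simp

theorem scalarMap_baseChange {V W : Type*} [AddCommGroup V] [Module F V] [AddCommGroup W]
    [Module F W] (f : V →ₗ[F] W) (x : R ⊗[F] V) :
    scalarMap φ W (f.baseChange R x) = f.baseChange S (scalarMap φ V x) := by
  induction x using TensorProduct.induction_on with
  | zero => simp
  | add x y hx hy => simp only [map_add, hx, hy]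
  | tmul r v => simp

theorem endMap_rhoPlus (u : R ⊗[F] CliffordAlgebra n) :
    endMap φ C (rhoPlus h R u) = rhoPlus h S (cliffordMap φ n u) :=
  linearMap_ext_scalarMap φ fun x => by
    rw [endMap_scalarMap, rhoPlus_apply, rhoPlus_apply, sndExt, inrExt, scalarMap_baseChange,
      scalarMap_cliffordRepExt, scalarMap_baseChange]
    rfl

theorem endMap_rhoMinus (u : R ⊗[F] CliffordAlgebra n) :
    endMap φ C (rhoMinus h R u) = rhoMinus h S (cliffordMap φ n u) :=
  linearMap_ext_scalarMap φ fun x => by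
    rw [endMap_scalarMap, rhoMinus_apply, rhoMinus_apply, fstExt, inlExt, scalarMap_baseChange,
      scalarMap_cliffordRepExt, scalarMap_baseChange]
    rfl

theorem cliffordMap_cliffordEmbExt (u : R ⊗[F] CliffordAlgebra (negNorm n)) :
    cliffordMap φ n (cliffordEmbExt h R u) = cliffordEmbExt h S (cliffordMap φ _ u) := by
  induction u using TensorProduct.induction_on with
  | zero => simp
  | add x y hx hy => simp only [map_add, hx, hy]
  | tmul r v => simp [cliffordEmbExt_tmul]

variable [Invertible (2 : F)]

/-- The equation for χ is S-linear in x, so it need only be checked on the image of C_R; the blocks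
ρ⁺ and ρ⁻ commute with base change. -/
theorem IsTrialityTriple.map {u : spin n R} {f : relatedTriples n R}
    (hf : IsTrialityTriple h u f) {v : spin n S}
    (hv : v.1 = Units.map (cliffordMap φ n : R ⊗[F] CliffordAlgebra n →*
      S ⊗[F] CliffordAlgebra n) u.1) :
    IsTrialityTriple h v (relatedTriplesHom h φ f) := by
  refine ⟨fun x => ?_, ?_, ?_⟩
  · have e : iotaExt n S ∘ₗ endMap φ C f.1.1 =
        LinearMap.mulLeft S (v.1 : S ⊗[F] CliffordAlgebra n) ∘ₗ
          LinearMap.mulRight S ((v.1⁻¹ : (S ⊗[F] CliffordAlgebra n)ˣ) :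
            S ⊗[F] CliffordAlgebra n) ∘ₗ iotaExt n S := by
      refine linearMap_ext_scalarMap φ fun x => ?_
      change iotaExt n S (endMap φ C f.1.1 (scalarMap φ C x)) =
        v.1 * (iotaExt n S (scalarMap φ C x) * ↑v.1⁻¹)
      rw [endMap_scalarMap, iotaExt_scalarMap, iotaExt_scalarMap, hf.1, hv, map_mul, map_mul,
        mul_assoc]
      rfl
    have e' := LinearMap.congr_fun e x
    refine e'.trans ?_
    exact (mul_assoc _ _ _).symm
  · rw [hv]
    exact (congrArg (endMap φ C) hf.2.1).trans (endMap_rhoPlus h φ _)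
  · rw [hv]
    exact (congrArg (endMap φ C) hf.2.2).trans (endMap_rhoMinus h φ _)

/-- The homomorphism from the `R`-points to the `S`-points of the spin group scheme that is induced
by `φ : R → S`. -/
def spinMap {V : Type v} [AddCommGroup V] [Module F V] (φ : R →ₐ[F] S) (q : QuadraticForm F V) :
    spin q R →* spin q S :=
  ((Units.map (cliffordMap φ q : R ⊗[F] CliffordAlgebra q →* S ⊗[F] CliffordAlgebra q)).comp
    (spin q R).subtype).codRestrict (spin q S) fun a => spin_map φ q a.2

theorem spinEmb_spinMap (u : spin (negNorm n) R) :
    spinEmb h S (spinMap φ _ u) = spinMap φ _ (spinEmb h R u) :=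
  Subtype.ext (Units.ext (cliffordMap_cliffordEmbExt h φ _).symm)

theorem trialityHom_spinMap (u : spin n R) :
    trialityHom h S (spinMap φ n u) = relatedTriplesHom h φ (trialityHom h R u) :=
  IsTrialityTriple.unique h (isTrialityTriple_trialityHom h _)
    ((isTrialityTriple_trialityHom h u).map h φ rfl)

theorem unityTrialityHom_spinMap (u : spin (negNorm n) R) :
    unityTrialityHom h S (spinMap φ _ u) = unityTriplesHom h φ (unityTrialityHom h R u) := by
  refine Subtype.ext ?_
  change (trialityHom h S (spinEmb h S (spinMap φ _ u))).1 =
    (relatedTriplesHom h φ (trialityHom h R (spinEmb h R u))).1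
  rw [spinEmb_spinMap, trialityHom_spinMap]

end Naturality

/-! ### Assembly into isomorphisms of group schemes -/

section Schemes

variable {F : Type u} [Field F] [Invertible (2 : F)]
variable {C : Type v} [NonAssocRing C] [Module F C] [SMulCommClass F C C] [IsScalarTower F C C]
variable {n : QuadraticForm F C} (h : IsCayley n)

/-- The homomorphism of spin group schemes induced by `Ψ`. -/
def spinSchemeEmb : spinScheme (negNorm n) ⟶ spinScheme n where
  app R := GrpCat.ofHom (spinEmb h R)
  naturality _ _ φ := GrpCat.hom_ext (MonoidHom.ext (spinEmb_spinMap h φ.hom))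

/-- The homomorphism `u ↦ (χ_u, ρ⁺_u, ρ⁻_u)` of group schemes. -/
def trialityTrans : spinScheme n ⟶ relatedTripleScheme h where
  app R := GrpCat.ofHom (trialityHom h R)
  naturality _ _ φ := GrpCat.hom_ext (MonoidHom.ext (trialityHom_spinMap h φ.hom))

/-- The homomorphism `u ↦ (χ_{Ψ(u)}, ρ⁺_{Ψ(u)}, ρ⁻_{Ψ(u)})` of group schemes. -/
def unityTrialityTrans : spinScheme (negNorm n) ⟶ unityTripleScheme h where
  app R := GrpCat.ofHom (unityTrialityHom h R)
  naturality _ _ φ := GrpCat.hom_ext (MonoidHom.ext (unityTrialityHom_spinMap h φ.hom))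

theorem isIso_ofHom_of_bijective {G H : Type w} [Group G] [Group H] (f : G →* H)
    (hf : Function.Bijective f) : IsIso (GrpCat.ofHom f) :=
  (MulEquiv.toGrpIso (X := GrpCat.of G) (Y := GrpCat.of H) (MulEquiv.ofBijective f hf)).isIso_hom

/-- The isomorphism `u ↦ (χ_u, ρ⁺_u, ρ⁻_u)` from the spin group scheme to the scheme of related
triples. -/
def trialityIso : spinScheme n ≅ relatedTripleScheme h :=
  have (R : CommAlgCat.{max u v, u} F) : IsIso ((trialityTrans h).app R) :=
    isIso_ofHom_of_bijective _ (trialityHom_bijective h)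
  have := NatIso.isIso_of_isIso_app (trialityTrans h)
  asIso (trialityTrans h)

/-- The isomorphism from the spin group scheme of `(C₀, -n)` to the scheme of related triples that
fix the unity. -/
def unityTrialityIso : spinScheme (negNorm n) ≅ unityTripleScheme h :=
  have (R : CommAlgCat.{max u v, u} F) : IsIso ((unityTrialityTrans h).app R) :=
    isIso_ofHom_of_bijective _ (unityTrialityHom_bijective h)
  have := NatIso.isIso_of_isIso_app (unityTrialityTrans h)
  asIso (unityTrialityTrans h)

end Schemes

end SpinTriality

end

theorem proposition3p5 {F : Type u} [Field F] [Invertible (2 : F)]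
    {C : Type v} [NonAssocRing C] [Module F C] [SMulCommClass F C C] [IsScalarTower F C C]
    {n : QuadraticForm F C} (h : SpinTriality.IsCayley n) :
    ∃ (α : SpinTriality.spinScheme n ≅ SpinTriality.relatedTripleScheme h)
      (ψ : SpinTriality.spinScheme (SpinTriality.negNorm n) ⟶ SpinTriality.spinScheme n)
      (β : SpinTriality.spinScheme (SpinTriality.negNorm n) ≅ SpinTriality.unityTripleScheme h),
      (∀ (R : CommAlgCat.{max u v, u} F) (a : SpinTriality.spin n R),
        SpinTriality.IsTrialityTriple h a (α.hom.app R a)) ∧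
      (∀ (R : CommAlgCat.{max u v, u} F) (a : SpinTriality.spin (SpinTriality.negNorm n) R),
        SpinTriality.IsCliffordImage h a (ψ.app R a)) ∧
      β.hom ≫ SpinTriality.unityTripleIncl h = ψ ≫ α.hom := by
  refine ⟨SpinTriality.trialityIso h, SpinTriality.spinSchemeEmb h,
    SpinTriality.unityTrialityIso h,
    fun R a => SpinTriality.isTrialityTriple_trialityHom h a, fun R a => rfl, ?_⟩
  -- On R-points both sides have the same underlying triple: `unityTrialityHom` is built from
  -- `trialityHom` after `spinEmb`.
  ext R a
  rfl
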